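/- Let $\omega\ge 1$ be an integer and let $\gamma(\theta,t)$, $t\in(0,\infty)$, be a global smooth entropy flow of (strictly) locally convex closed plane curves of winding number $\omega$, each parametrised by its normal angle $\theta\in\mathbb{R}/2\omega\pi\mathbb{Z}$. That is, the inward unit normal is $N(\theta)=-(\cos\theta,\sin\theta)$, and $\langle\partial_t\gamma,N\rangle=-(k_{\theta\theta}+k)$, where $k>0$ is the curvature and $\theta,t$ are independent variables. (The flow starting from an initial curve that is either immersed, closed, locally convex and of class $C^2$, or embedded with square-integrable curvature and bounding a convex domain, is such a flow.) Let $L_0>0$ (for instance the length of the initial curve) and $c>0$, put $\phi(t)=\sqrt{L_0^2+2ct}$, and consider the rescaled flow $\gamma/\phi$ as a function of $\theta$ and of the new time $\tau$ with $\tau=0$ at $t=0$ and $dt/d\tau=\phi^2$. From now on write $t$ for the new time $\tau$, and let $h(\theta,t)=\langle\cdot,-N(\theta)\rangle$ and $k(\theta,t)$ be the support function and the curvature of the rescaled flow. Write $\|f\|_2^2=\int_0^{2\omega\pi}f^2\,d\theta$. Then: 1. $h_t=k_{\theta\theta}+k-c\,h$ for all $t>0$. 2. For every $T\in\mathbb{R}$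 there are constants $\varepsilon_i\in(0,1/(22\omega\pi)]$ and $\alpha_i$ and times $t_i>0$ with $T\le t_i\le t_{i+1}$ ($i=1,2,3,\dots$) such that for each $i\ge1$ and all $t\ge t_i$ $$\|(\log k)_\theta\|_2^2(t)\le\varepsilon_i\qquad\text{and}\qquad \|\partial_\theta^i h\|_2^2(t)\le\alpha_i e^{-2ct}.$$ 3. There is a constant $r>0$ such that $h(\cdot,t)\to r$ in $C^\infty(d\theta)$ as $t\to\infty$, that is, $\partial_\theta^i h(\cdot,t)\to\partial_\theta^i r$ uniformly in $\theta$ for every $i\ge0$. The choice $c=1$ gives the equation $h_t=k_{\theta\theta}+k-h$ with decay $e^{-2t}$. The choice $c=4\omega^2\pi^2$ gives $\phi=\sqrt{L_0^2+8\omega^2\pi^2t}$ with decay $e^{-8\omega^2\pi^2t}\le e^{-2t}$ for $t\ge0$. -/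

import Mathlib

open Real Set Filter Topology
open scoped ContDiff InnerProductSpace

noncomputable section

namespace EntropyFlow

/-- The Euclidean plane. -/
abbrev Plane : Type := EuclideanSpace ℝ (Fin 2)

/-- The inward unit normal `N(θ) = -(cos θ, sin θ)` at the point with normal angle `θ`. -/
def inwardNormal (θ : ℝ) : Plane := !₂[-cos θ, -sin θ]

/-- The unit tangent `T(θ) = (-sin θ, cos θ)` at the point with normal angle `θ`. -/
def unitTangent (θ : ℝ) : Plane := !₂[-sin θ, cos θ]

/-- The support function `h(θ) = ⟨γ(θ), -N(θ)⟩` of a curve parametrised by its normal angle. -/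
def support (γ : ℝ → Plane) (θ : ℝ) : ℝ := ⟪γ θ, -inwardNormal θ⟫_ℝ

/-- The curvature scalar `k = ⟨γ_θθ, N⟩ / |γ_θ|²` of a curve parametrised by its normal angle. -/
def curvature (γ : ℝ → Plane) (θ : ℝ) : ℝ :=
  ⟪iteratedDeriv 2 γ θ, inwardNormal θ⟫_ℝ / ‖deriv γ θ‖ ^ 2

/-- `IsLocallyConvexClosed w γ`: the curve `γ` is regular, closed with winding number `w`, and
parametrised by its normal angle `θ ∈ ℝ / 2wπℤ`, i.e. its unit tangent at parameter `θ` is `T(θ)`.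
(A smooth curve is strictly locally convex exactly if it can be parametrised in this way; then
`k = 1 / |γ_θ| > 0`.) -/
structure IsLocallyConvexClosed (w : ℕ) (γ : ℝ → Plane) : Prop where
  periodic : Function.Periodic γ (2 * w * π)
  regular : ∀ θ, deriv γ θ ≠ 0
  angle : ∀ θ, deriv γ θ = ‖deriv γ θ‖ • unitTangent θ

/-- `IsGlobalFlow w γ`: the family `γ t`, `t ∈ (0, ∞)`, is a smooth entropy flow of locally convex
closed curves with winding number `w`, i.e. its normal velocity `⟨∂_t γ, N⟩` is `-(k_θθ + k)`, where
`θ` and `t` are independent variables. Values at `t ≤ 0` are irrelevant. -/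
structure IsGlobalFlow (w : ℕ) (γ : ℝ → ℝ → Plane) : Prop where
  smooth : ContDiffOn ℝ ∞ (fun p : ℝ × ℝ => γ p.1 p.2) (Ioi 0 ×ˢ univ)
  convex : ∀ t, 0 < t → IsLocallyConvexClosed w (γ t)
  velocity : ∀ t, 0 < t → ∀ θ,
    ⟪deriv (fun s => γ s θ) t, inwardNormal θ⟫_ℝ
      = -(iteratedDeriv 2 (curvature (γ t)) θ + curvature (γ t) θ)

/-- The scaling factor `φ(t) = √(L₀² + 2 c t)`. -/
def scaleFactor (L₀ c t : ℝ) : ℝ := √(L₀ ^ 2 + 2 * c * t)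

/-- The original time `t` as a function of the rescaled time `τ`, where `dt/dτ = φ(t)²` and
`t = 0` at `τ = 0`. -/
def originalTime (L₀ c τ : ℝ) : ℝ := L₀ ^ 2 * (exp (2 * c * τ) - 1) / (2 * c)

theorem originalTime_zero (L₀ c : ℝ) : originalTime L₀ c 0 = 0 := by
  simp [originalTime]

theorem hasDerivAt_originalTime (L₀ : ℝ) {c : ℝ} (hc : c ≠ 0) (τ : ℝ) :
    HasDerivAt (originalTime L₀ c) (scaleFactor L₀ c (originalTime L₀ c τ) ^ 2) τ := by
  have hval : scaleFactor L₀ c (originalTime L₀ c τ) ^ 2 = L₀ ^ 2 * exp (2 * c * τ) := by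
    have h1 : L₀ ^ 2 + 2 * c * originalTime L₀ c τ = L₀ ^ 2 * exp (2 * c * τ) := by
      unfold originalTime
      field_simp
      ring
    rw [scaleFactor, h1, sq_sqrt (by positivity)]
  rw [hval]
  have h := ((((hasDerivAt_id τ).const_mul (2 * c)).exp.sub_const 1).const_mul
    (L₀ ^ 2)).div_const (2 * c)
  refine h.congr_deriv ?_
  simp only [id, mul_one]
  field_simp

/-- The rescaled flow `η(θ, τ) = γ(θ, t) / φ(t)`, where `t` is the original time at the rescaled
time `τ`. -/
def rescaled (L₀ c : ℝ) (γ : ℝ → ℝ → Plane) (τ : ℝ) (θ : ℝ) : Plane :=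
  (scaleFactor L₀ c (originalTime L₀ c τ))⁻¹ • γ (originalTime L₀ c τ) θ

end EntropyFlow

end

/-! With `u = h'' + h` the radius of curvature and `k = 1/u`, the rescaled flow is the scalar
equation `h_t = k'' + k - c h`, whose stationary circle has radius `r = 1/√c`. Two facts drive the
proof: `∂² + 1` is self-adjoint on periodic functions, and `u ↦ 1/u` is decreasing. Pairing the
equation with `h - r` produces `∫ (u - r)(1/u - 1/r) ≤ 0`, so the damping `-c h` alone forces `∫ (h
- r)²` to decay like `e^{-2ct}` (`integral_sq_sub_decay`). The linearised equation gives the same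
decay for the speed `h_t` (`integral_sq_speed_decay`).

Hence `(k - √c)'' + (k - √c) = h_t + c (h - r)` is small in `L²`, and `k - √c` is `C¹`-close to some
`a cos θ + b sin θ` (`exists_kernel_approx`). The closing of the curve makes `u` orthogonal to `cos`
and `sin`, and this forces `a` and `b` to be small too (`kernel_coeff_bound`). So `k → √c` in `C¹`
(`curv_convergence`); this yields the claim on `(log k)_θ` and bounds `k` away from `0` and `∞`.

For higher derivatives, differentiating `k u = 1` expresses `k^(n)` through `u^(n)` and mixed
products `S`. The energy of `h^(n)` is then damped at rate `2c`, with the extra dissipation `(c/4) ∫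
(u^(n))²` and the error `∫ S²` (`energy_deriv_le`). That error is at most a constant times `∫
(u^(n-1))²`, which the dissipation one level below absorbs; adding a multiple of the previous
functional therefore keeps the full rate `2c` (`hasLyapunov_and_energy_curv_isBigO`). A Sobolev
inequality turns the decay into uniform convergence. -/

noncomputable section

namespace EntropyFlow

/-! ### Families of functions smooth in angle and positive time -/

/-- A family of functions on the line that depends smoothly on a positive time. -/
def SmoothFamily (F : ℝ → ℝ → ℝ) : Prop :=
  ContDiffOn ℝ ∞ (fun p : ℝ × ℝ => F p.1 p.2) (Ioi 0 ×ˢ univ)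

namespace SmoothFamily

variable {F G : ℝ → ℝ → ℝ} {t : ℝ}

theorem contDiffAt (hF : SmoothFamily F) (ht : 0 < t) (θ : ℝ) :
    ContDiffAt ℝ ∞ (fun p : ℝ × ℝ => F p.1 p.2) (t, θ) :=
  ContDiffOn.contDiffAt hF ((isOpen_Ioi.prod isOpen_univ).mem_nhds ⟨ht, mem_univ θ⟩)

theorem of_contDiffAt
    (h : ∀ t, 0 < t → ∀ θ, ContDiffAt ℝ ∞ (fun p : ℝ × ℝ => F p.1 p.2) (t, θ)) :
    SmoothFamily F := fun p hp => (h p.1 hp.1 p.2).contDiffWithinAt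

theorem congr (hF : SmoothFamily F) (h : ∀ t, 0 < t → ∀ θ, G t θ = F t θ) : SmoothFamily G :=
  ContDiffOn.congr hF fun p hp => h p.1 hp.1 p.2

theorem slice (hF : SmoothFamily F) (ht : 0 < t) : ContDiff ℝ ∞ (F t) := by
  rw [contDiff_iff_contDiffAt]
  intro θ
  exact (hF.contDiffAt ht θ).comp θ (f := fun x : ℝ => (t, x)) (by fun_prop)

theorem const (a : ℝ) : SmoothFamily fun _ _ => a := contDiffOn_const

theorem add (hF : SmoothFamily F) (hG : SmoothFamily G) : SmoothFamily fun t θ => F t θ + G t θ :=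
  ContDiffOn.add hF hG

theorem sub (hF : SmoothFamily F) (hG : SmoothFamily G) : SmoothFamily fun t θ => F t θ - G t θ :=
  ContDiffOn.sub hF hG

theorem mul (hF : SmoothFamily F) (hG : SmoothFamily G) : SmoothFamily fun t θ => F t θ * G t θ :=
  ContDiffOn.mul hF hG

theorem inv (hF : SmoothFamily F) (h : ∀ t, 0 < t → ∀ θ, F t θ ≠ 0) :
    SmoothFamily fun t θ => (F t θ)⁻¹ :=
  ContDiffOn.inv hF fun p hp => h p.1 hp.1 p.2

theorem fderiv_apply (hF : SmoothFamily F) (v : ℝ × ℝ) :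
    SmoothFamily fun t θ => fderiv ℝ (fun p : ℝ × ℝ => F p.1 p.2) (t, θ) v :=
  of_contDiffAt fun _ ht θ =>
    ((hF.contDiffAt ht θ).fderiv_right (m := ∞) (by simp)).clm_apply contDiffAt_const

theorem hasDerivAt_angle (hF : SmoothFamily F) (ht : 0 < t) (θ : ℝ) :
    HasDerivAt (F t) (fderiv ℝ (fun p : ℝ × ℝ => F p.1 p.2) (t, θ) (0, 1)) θ := by
  have h1 := ((hF.contDiffAt ht θ).differentiableAt (by simp)).hasFDerivAt
  exact h1.comp_hasDerivAt θ (f := fun x => (t, x))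
    ((hasDerivAt_const θ t).prodMk (hasDerivAt_id θ))

theorem hasDerivAt_time (hF : SmoothFamily F) (ht : 0 < t) (θ : ℝ) :
    HasDerivAt (fun s => F s θ) (fderiv ℝ (fun p : ℝ × ℝ => F p.1 p.2) (t, θ) (1, 0)) t := by
  have h1 := ((hF.contDiffAt ht θ).differentiableAt (by simp)).hasFDerivAt
  exact h1.comp_hasDerivAt t (f := fun x => (x, θ))
    ((hasDerivAt_id t).prodMk (hasDerivAt_const t θ))

protected theorem deriv (hF : SmoothFamily F) : SmoothFamily fun t => deriv (F t) :=
  (hF.fderiv_apply (0, 1)).congr fun _ ht θ => (hF.hasDerivAt_angle ht θ).deriv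

protected theorem iteratedDeriv (hF : SmoothFamily F) (n : ℕ) :
    SmoothFamily fun t => iteratedDeriv n (F t) := by
  induction n with
  | zero => simpa using hF
  | succ n ih => simpa only [iteratedDeriv_succ] using ih.deriv

/-- Uniqueness of derivatives identifies `G` with the joint derivative of `F` in the direction `(1,
0)`, so the smoothness of a time derivative never needs a separate proof. -/
theorem of_hasDerivAt (hF : SmoothFamily F)
    (h : ∀ t, 0 < t → ∀ θ, HasDerivAt (fun s => F s θ) (G t θ) t) : SmoothFamily G :=
  (hF.fderiv_apply (1, 0)).congr fun t ht θ => (h t ht θ).unique (hF.hasDerivAt_time ht θ)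

/-- Symmetry of the second derivative of the joint function: angle and time derivatives commute. -/
theorem hasDerivAt_deriv (hF : SmoothFamily F)
    (h : ∀ t, 0 < t → ∀ θ, HasDerivAt (fun s => F s θ) (G t θ) t) (ht : 0 < t) (θ : ℝ) :
    HasDerivAt (fun s => deriv (F s) θ) (deriv (G t) θ) t := by
  set f : ℝ × ℝ → ℝ := fun p => F p.1 p.2 with hf
  have hsymm : IsSymmSndFDerivAt ℝ f (t, θ) :=
    (hF.contDiffAt ht θ).isSymmSndFDerivAt
      (by simpa using WithTop.coe_le_coe.2 (le_top (a := (2 : ℕ∞))))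
  have hd : DifferentiableAt ℝ (fderiv ℝ f) (t, θ) :=
    ((hF.contDiffAt ht θ).fderiv_right (m := ∞) (by simp)).differentiableAt (by simp)
  have h1 : HasDerivAt (fun s => fderiv ℝ f (s, θ) (0, 1))
      (fderiv ℝ (fderiv ℝ f) (t, θ) (1, 0) (0, 1)) t :=
    (hd.hasFDerivAt.comp_hasDerivAt t (f := fun x => (x, θ))
      ((hasDerivAt_id t).prodMk (hasDerivAt_const t θ))).clm_apply
      (hasDerivAt_const t ((0, 1) : ℝ × ℝ)) |>.congr_deriv (by simp)
  have h2 : HasDerivAt (fun x => fderiv ℝ f (t, x) (1, 0))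
      (fderiv ℝ (fderiv ℝ f) (t, θ) (0, 1) (1, 0)) θ :=
    (hd.hasFDerivAt.comp_hasDerivAt θ (f := fun x => (t, x))
      ((hasDerivAt_const θ t).prodMk (hasDerivAt_id θ))).clm_apply
      (hasDerivAt_const θ ((1, 0) : ℝ × ℝ)) |>.congr_deriv (by simp)
  have h3 : G t = fun x => fderiv ℝ f (t, x) (1, 0) :=
    funext fun x => (h t ht x).unique (hF.hasDerivAt_time ht x)
  rw [h3, h2.deriv, ← hsymm.eq]
  refine h1.congr_of_eventuallyEq ?_
  filter_upwards [lt_mem_nhds ht] with s hs using (hF.hasDerivAt_angle hs θ).deriv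

theorem hasDerivAt_iteratedDeriv (hF : SmoothFamily F)
    (h : ∀ t, 0 < t → ∀ θ, HasDerivAt (fun s => F s θ) (G t θ) t) (n : ℕ) :
    ∀ t, 0 < t → ∀ θ, HasDerivAt (fun s => iteratedDeriv n (F s) θ) (iteratedDeriv n (G t) θ) t := by
  induction n with
  | zero => simpa using h
  | succ n ih =>
    intro t ht θ
    simpa only [iteratedDeriv_succ] using (hF.iteratedDeriv n).hasDerivAt_deriv ih ht θ

/-- Differentiation under the integral; the dominating constant is a bound for `G` on the compact
set `[t/2, 2t] × [a, b]`, which stays inside positive times. -/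
theorem hasDerivAt_integral (hF : SmoothFamily F)
    (h : ∀ t, 0 < t → ∀ θ, HasDerivAt (fun s => F s θ) (G t θ) t) (a b : ℝ) (ht : 0 < t) :
    HasDerivAt (fun s => ∫ θ in a..b, F s θ) (∫ θ in a..b, G t θ) t := by
  have hG := hF.of_hasDerivAt h
  have hcpt : IsCompact (Icc (t / 2) (2 * t) ×ˢ uIcc a b) := isCompact_Icc.prod isCompact_uIcc
  have hpos : ∀ s ∈ Icc (t / 2) (2 * t), 0 < s := fun s hs => by linarith [hs.1]
  obtain ⟨M, hM⟩ := hcpt.exists_bound_of_continuousOn (f := fun p : ℝ × ℝ => G p.1 p.2)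
    (ContinuousOn.mono (ContDiffOn.continuousOn hG) fun p hp => ⟨hpos _ hp.1, mem_univ _⟩)
  have hnhds : Icc (t / 2) (2 * t) ∈ 𝓝 t := Icc_mem_nhds (by linarith) (by linarith)
  refine (intervalIntegral.hasDerivAt_integral_of_dominated_loc_of_deriv_le
    (bound := fun _ => M) hnhds ?_ ?_ ?_ ?_ (by simp) ?_).2
  · filter_upwards [lt_mem_nhds ht] with s hs
      using (hF.slice hs).continuous.aestronglyMeasurable
  · exact (hF.slice ht).continuous.intervalIntegrable _ _
  · exact (hG.slice ht).continuous.aestronglyMeasurable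
  · exact Eventually.of_forall fun θ hθ s hs => hM (s, θ) ⟨hs, uIoc_subset_uIcc hθ⟩
  · exact Eventually.of_forall fun θ _ s hs => h s (hpos s hs) θ

theorem hasDerivAt_integral_sq (hF : SmoothFamily F)
    (h : ∀ t, 0 < t → ∀ θ, HasDerivAt (fun s => F s θ) (G t θ) t) (a b : ℝ) (ht : 0 < t) :
    HasDerivAt (fun s => ∫ θ in a..b, F s θ ^ 2) (∫ θ in a..b, 2 * (F t θ * G t θ)) t := by
  have hsq : SmoothFamily fun t θ => F t θ ^ 2 := (hF.mul hF).congr fun _ _ _ => sq _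
  refine hsq.hasDerivAt_integral (G := fun t θ => 2 * (F t θ * G t θ)) (fun t ht θ => ?_) a b ht
  refine ((h t ht θ).pow 2).congr_deriv ?_
  simp
  ring

end SmoothFamily

/-! ### Periodic functions of one variable -/

section Periodic

variable {f g : ℝ → ℝ} {P : ℝ}

theorem periodic_deriv (hf : Function.Periodic f P) : Function.Periodic (deriv f) P := by
  intro x
  rw [← deriv_comp_add_const]
  congr 1
  exact funext hf

theorem periodic_iteratedDeriv (hf : Function.Periodic f P) (n : ℕ) :
    Function.Periodic (iteratedDeriv n f) P := by
  induction n with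
  | zero => simpa using hf
  | succ n ih => simpa only [iteratedDeriv_succ] using periodic_deriv ih

theorem contDiff_iteratedDeriv (hf : ContDiff ℝ ∞ f) (n : ℕ) : ContDiff ℝ ∞ (iteratedDeriv n f) := by
  rw [iteratedDeriv_eq_iterate]
  exact hf.iterate_deriv n

theorem contDiff_deriv (hf : ContDiff ℝ ∞ f) : ContDiff ℝ ∞ (deriv f) := by
  simpa using contDiff_iteratedDeriv hf 1

theorem hasDerivAt_of_contDiff (hf : ContDiff ℝ ∞ f) (x : ℝ) : HasDerivAt f (deriv f x) x :=
  (hf.differentiable (by simp) x).hasDerivAt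

theorem integral_mul_deriv_periodic (hf : ContDiff ℝ ∞ f) (hg : ContDiff ℝ ∞ g)
    (hfP : Function.Periodic f P) (hgP : Function.Periodic g P) :
    ∫ x in (0 : ℝ)..P, f x * deriv g x = -∫ x in (0 : ℝ)..P, deriv f x * g x := by
  rw [intervalIntegral.integral_mul_deriv_eq_deriv_mul
    (fun x _ => hasDerivAt_of_contDiff hf x) (fun x _ => hasDerivAt_of_contDiff hg x)
    ((contDiff_deriv hf).continuous.intervalIntegrable _ _)
    ((contDiff_deriv hg).continuous.intervalIntegrable _ _), hfP.eq, hgP.eq]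
  ring

/-- Two integrations by parts without boundary terms: `∂² + 1` is self-adjoint. It underlies the
energy identities and the closing condition. -/
theorem integral_mul_iteratedDeriv_two_add (hf : ContDiff ℝ ∞ f) (hg : ContDiff ℝ ∞ g)
    (hfP : Function.Periodic f P) (hgP : Function.Periodic g P) :
    ∫ x in (0 : ℝ)..P, f x * (iteratedDeriv 2 g x + g x) =
      ∫ x in (0 : ℝ)..P, (iteratedDeriv 2 f x + f x) * g x := by
  have hf' := contDiff_deriv hf
  have hg' := contDiff_deriv hg
  have h1 := integral_mul_deriv_periodic hf hg' hfP (periodic_deriv hgP)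
  have h2 := integral_mul_deriv_periodic hf' hg (periodic_deriv hfP) hgP
  have hf2 := (contDiff_deriv hf').continuous
  have hg2 := (contDiff_deriv hg').continuous
  have hfc := hf.continuous
  have hgc := hg.continuous
  simp only [iteratedDeriv_succ, iteratedDeriv_zero, mul_add, add_mul]
  rw [intervalIntegral.integral_add ((by fun_prop : Continuous _).intervalIntegrable _ _)
      ((by fun_prop : Continuous _).intervalIntegrable _ _),
    intervalIntegral.integral_add ((by fun_prop : Continuous _).intervalIntegrable _ _)
      ((by fun_prop : Continuous _).intervalIntegrable _ _), h1, h2, neg_neg]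

/-- Cauchy–Schwarz, read off from the nonnegativity of the variance. -/
theorem sq_integral_le (hP : 0 < P) (hf : Continuous f) :
    (∫ x in (0 : ℝ)..P, f x) ^ 2 ≤ P * ∫ x in (0 : ℝ)..P, f x ^ 2 := by
  set I := ∫ x in (0 : ℝ)..P, f x with hI
  have h0 : 0 ≤ ∫ x in (0 : ℝ)..P, (f x - I / P) ^ 2 :=
    intervalIntegral.integral_nonneg hP.le fun _ _ => sq_nonneg _
  have h1 : ∫ x in (0 : ℝ)..P, (f x - I / P) ^ 2 =
      (∫ x in (0 : ℝ)..P, f x ^ 2) - 2 * (I / P) * I + P * (I / P) ^ 2 := by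
    have : ∀ x, (f x - I / P) ^ 2 = f x ^ 2 - 2 * (I / P) * f x + (I / P) ^ 2 := fun x => by ring
    simp only [this]
    rw [intervalIntegral.integral_add ((by fun_prop : Continuous _).intervalIntegrable _ _)
        ((by fun_prop : Continuous _).intervalIntegrable _ _),
      intervalIntegral.integral_sub ((by fun_prop : Continuous _).intervalIntegrable _ _)
        ((by fun_prop : Continuous _).intervalIntegrable _ _),
      intervalIntegral.integral_const_mul]
    simp [hI]
  rw [h1] at h0
  have h2 : P * ((∫ x in (0 : ℝ)..P, f x ^ 2) - 2 * (I / P) * I + P * (I / P) ^ 2) =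
      P * (∫ x in (0 : ℝ)..P, f x ^ 2) - I ^ 2 := by
    field_simp
    ring
  have h3 := mul_nonneg hP.le h0
  linarith

theorem abs_integral_le_of_mem (hf : Continuous f) {x y : ℝ} (hx : x ∈ Icc 0 P)
    (hy : y ∈ Icc 0 P) : |∫ s in x..y, f s| ≤ ∫ s in (0 : ℝ)..P, |f s| := by
  wlog hxy : x ≤ y generalizing x y
  · rw [intervalIntegral.integral_symm, abs_neg]
    exact this hy hx (le_of_not_ge hxy)
  refine (intervalIntegral.abs_integral_le_integral_abs hxy).trans ?_
  exact intervalIntegral.integral_mono_interval hx.1 hxy hy.2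
    (Eventually.of_forall fun _ => abs_nonneg _) (hf.abs.intervalIntegrable _ _)

/-- The representative `y` is chosen before `f`, so that it serves a function and its derivative at
once. -/
theorem exists_mem_Icc_periodic (hP : 0 < P) (x : ℝ) :
    ∃ y ∈ Icc 0 P, ∀ f : ℝ → ℝ, Function.Periodic f P → f x = f y := by
  obtain ⟨y, hy, n, hn⟩ := existsUnique_add_zsmul_mem_Ico hP x 0 |>.exists |> fun ⟨n, hn⟩ =>
    (⟨x + n • P, hn, n, rfl⟩ : ∃ y ∈ Ico 0 (0 + P), ∃ n : ℤ, y = x + n • P)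
  refine ⟨y, ⟨hy.1, by simpa using hy.2.le⟩, fun f hf => ?_⟩
  rw [hn, (hf.zsmul n) x]

/-- By Rolle, `f'` vanishes somewhere in the period; from there it is the integral of `f''`, and
Cauchy–Schwarz applies. -/
theorem sq_deriv_le_integral (hP : 0 < P) (hf : ContDiff ℝ ∞ f) (hfP : Function.Periodic f P)
    (x : ℝ) : deriv f x ^ 2 ≤ P * ∫ s in (0 : ℝ)..P, deriv (deriv f) s ^ 2 := by
  obtain ⟨y, hy, hxy⟩ := exists_mem_Icc_periodic hP x
  rw [hxy _ (periodic_deriv hfP)]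
  obtain ⟨z, hz, hz0⟩ := exists_deriv_eq_zero hP hf.continuous.continuousOn hfP.eq.symm
  have hf' := contDiff_deriv hf
  have hf2 := (contDiff_deriv hf').continuous
  have h1 : ∫ s in z..y, deriv (deriv f) s = deriv f y := by
    rw [intervalIntegral.integral_deriv_eq_sub' _ rfl
      (fun s _ => hf'.differentiable (by simp) s) hf2.continuousOn, hz0, sub_zero]
  have h2 := abs_integral_le_of_mem hf2 (Ioo_subset_Icc_self hz) hy
  rw [h1] at h2
  have h3 := sq_integral_le hP hf2.abs
  simp only [sq_abs] at h3
  rw [← sq_abs]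
  exact (pow_le_pow_left₀ (abs_nonneg _) h2 2).trans h3

theorem integral_sq_deriv_le (hP : 0 < P) (hf : ContDiff ℝ ∞ f) (hfP : Function.Periodic f P) :
    ∫ s in (0 : ℝ)..P, deriv f s ^ 2 ≤ P ^ 2 * ∫ s in (0 : ℝ)..P, deriv (deriv f) s ^ 2 := by
  have hc : Continuous fun s => deriv f s ^ 2 := (contDiff_deriv hf).continuous.pow 2
  have h := intervalIntegral.integral_mono_on hP.le
    (hc.intervalIntegrable (μ := MeasureTheory.volume) 0 P)
    (intervalIntegrable_const (c := P * ∫ s in (0 : ℝ)..P, deriv (deriv f) s ^ 2))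
    fun x _ => sq_deriv_le_integral hP hf hfP x
  simp only [intervalIntegral.integral_const, smul_eq_mul, sub_zero] at h
  linarith

/-- Sobolev inequality: `f(y)² - f(z)² = ∫ 2 f f' ≤ ∫ (f² + f'²)`, then integrate over `z` in a
period. -/
theorem sq_le_integral_sq_add (hP : 0 < P) (hf : ContDiff ℝ ∞ f) (hfP : Function.Periodic f P)
    (x : ℝ) :
    f x ^ 2 ≤ (P⁻¹ + 1) * ((∫ s in (0 : ℝ)..P, f s ^ 2) + ∫ s in (0 : ℝ)..P, deriv f s ^ 2) := by
  obtain ⟨y, hy, hxy⟩ := exists_mem_Icc_periodic hP x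
  rw [hxy _ hfP]
  have hfc := hf.continuous
  have hf' := (contDiff_deriv hf).continuous
  set I := ∫ s in (0 : ℝ)..P, f s ^ 2 with hI
  set J := ∫ s in (0 : ℝ)..P, deriv f s ^ 2 with hJ
  have hI0 : 0 ≤ I := intervalIntegral.integral_nonneg hP.le fun _ _ => sq_nonneg _
  have hJ0 : 0 ≤ J := intervalIntegral.integral_nonneg hP.le fun _ _ => sq_nonneg _
  have hpt : ∀ z ∈ Icc 0 P, f y ^ 2 - f z ^ 2 ≤ I + J := by
    intro z hz
    have h1 : ∫ s in z..y, 2 * (f s * deriv f s) = f y ^ 2 - f z ^ 2 := by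
      refine intervalIntegral.integral_eq_sub_of_hasDerivAt (f := fun s => f s ^ 2)
        (fun s _ => ?_) ((by fun_prop : Continuous _).intervalIntegrable _ _)
      refine ((hasDerivAt_of_contDiff hf s).pow 2).congr_deriv ?_
      simp
      ring
    have h2 := abs_integral_le_of_mem (f := fun s => 2 * (f s * deriv f s)) (by fun_prop) hz hy
    have h3 : ∫ s in (0 : ℝ)..P, |2 * (f s * deriv f s)| ≤
        ∫ s in (0 : ℝ)..P, (f s ^ 2 + deriv f s ^ 2) := by
      refine intervalIntegral.integral_mono_on hP.le
        ((by fun_prop : Continuous _).intervalIntegrable _ _)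
        ((by fun_prop : Continuous _).intervalIntegrable _ _) fun s _ => ?_
      rw [abs_le]
      constructor <;> nlinarith [sq_nonneg (f s + deriv f s), sq_nonneg (f s - deriv f s)]
    rw [intervalIntegral.integral_add ((by fun_prop : Continuous _).intervalIntegrable _ _)
      ((by fun_prop : Continuous _).intervalIntegrable _ _)] at h3
    rw [h1] at h2
    exact (le_abs_self _).trans (h2.trans h3)
  have hc : Continuous fun s => f s ^ 2 := hfc.pow 2
  have h := intervalIntegral.integral_mono_on hP.le
    (intervalIntegrable_const (c := f y ^ 2 - (I + J)))
    (hc.intervalIntegrable (μ := MeasureTheory.volume) 0 P)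
    fun z hz => by linarith [hpt z hz]
  simp only [intervalIntegral.integral_const, smul_eq_mul, sub_zero] at h
  change P * (f y ^ 2 - (I + J)) ≤ I at h
  have h4 : f y ^ 2 - (I + J) ≤ P⁻¹ * I := by
    rw [inv_mul_eq_div, le_div_iff₀ hP]
    linarith [h]
  have : 0 ≤ P⁻¹ * J := by positivity
  linarith

end Periodic

/-! ### The flow of the support function -/

/-- The radius of curvature `h'' + h` of the curve with support function `h`. -/
def radius (h : ℝ → ℝ → ℝ) (t θ : ℝ) : ℝ := iteratedDeriv 2 (h t) θ + h t θ

/-- The curvature `1 / (h'' + h)` of the curve with support function `h`. -/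
def curv (h : ℝ → ℝ → ℝ) (t θ : ℝ) : ℝ := (radius h t θ)⁻¹

/-- The right-hand side of the rescaled entropy flow for the support function. -/
def speed (c : ℝ) (h : ℝ → ℝ → ℝ) (t θ : ℝ) : ℝ :=
  iteratedDeriv 2 (curv h t) θ + curv h t θ - c * h t θ

/-- Solutions of the rescaled entropy flow in terms of the support function. -/
structure SupportFlow (w : ℕ) (c : ℝ) (h : ℝ → ℝ → ℝ) : Prop where
  smooth : SmoothFamily h
  periodic : ∀ t, 0 < t → Function.Periodic (h t) (2 * w * π)
  radius_pos : ∀ t, 0 < t → ∀ θ, 0 < radius h t θ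
  evolution : ∀ t, 0 < t → ∀ θ, HasDerivAt (fun s => h s θ) (speed c h t θ) t

/-- Grönwall: `E(t) e^{-at}` is nonincreasing on `[T, ∞)`. -/
theorem exp_decay_of_deriv_le {E E' : ℝ → ℝ} {a T : ℝ}
    (hE : ∀ t, T ≤ t → HasDerivAt E (E' t) t) (hE' : ∀ t, T ≤ t → E' t ≤ a * E t) :
    ∀ t, T ≤ t → E t ≤ E T * exp (-(a * T)) * exp (a * t) := by
  have hd : ∀ t, T ≤ t → HasDerivAt (fun s => E s * exp (-(a * s)))
      (E' t * exp (-(a * t)) + E t * (exp (-(a * t)) * (-(a * 1)))) t := fun t ht =>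
    (hE t ht).mul (((hasDerivAt_id t).const_mul a).neg.exp)
  have hanti : AntitoneOn (fun s => E s * exp (-(a * s))) (Ici T) := by
    refine antitoneOn_of_deriv_nonpos (convex_Ici T)
      (fun t ht => (hd t ht).continuousAt.continuousWithinAt)
      (fun t ht => (hd t (interior_subset ht)).differentiableAt.differentiableWithinAt)
      fun t ht => ?_
    have ht' : T ≤ t := interior_subset ht
    rw [(hd t ht').deriv]
    have := mul_nonneg (sub_nonneg.2 (hE' t ht')) (exp_pos (-(a * t))).le
    linarith
  intro t ht
  have h1 := hanti self_mem_Ici ht ht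
  have h2 : exp (-(a * t)) * exp (a * t) = 1 := by rw [← exp_add]; simp
  calc E t = E t * exp (-(a * t)) * exp (a * t) := by rw [mul_assoc, h2, mul_one]
    _ ≤ _ := mul_le_mul_of_nonneg_right h1 (exp_pos _).le

theorem exists_exp_decay {E E' : ℝ → ℝ} {a : ℝ} (h : ∀ᶠ t in atTop, HasDerivAt E (E' t) t)
    (h' : ∀ᶠ t in atTop, E' t ≤ a * E t) : ∃ C, ∀ᶠ t in atTop, E t ≤ C * exp (a * t) := by
  obtain ⟨T, hT⟩ := eventually_atTop.1 (h.and h')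
  exact ⟨_, eventually_atTop.2 ⟨T, exp_decay_of_deriv_le (fun t ht => (hT t ht).1)
    fun t ht => (hT t ht).2⟩⟩

/-! ### Near-solutions of `f'' + f = 0` and the closing condition -/

/-- Solutions of `f'' + f = e` are close to the kernel of `∂² + 1` when `e` is small. -/
theorem exists_kernel_approx {f : ℝ → ℝ} {P : ℝ} (hf : ContDiff ℝ ∞ f) :
    ∃ a b : ℝ, ∀ x ∈ Icc 0 P,
      |f x - (a * cos x + b * sin x)| ≤ 2 * ∫ s in (0 : ℝ)..P, |iteratedDeriv 2 f s + f s| ∧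
      |deriv f x - (-a * sin x + b * cos x)| ≤
        2 * ∫ s in (0 : ℝ)..P, |iteratedDeriv 2 f s + f s| := by
  have hf' := contDiff_deriv hf
  have he : Continuous fun s => iteratedDeriv 2 f s + f s :=
    (contDiff_iteratedDeriv hf 2).continuous.add hf.continuous
  set e : ℝ → ℝ := fun s => iteratedDeriv 2 f s + f s with hedef
  have he2 : ∀ s, e s = deriv (deriv f) s + f s := fun s => by
    simp [hedef, iteratedDeriv_succ]
  -- Rotating `(f, f')` by the angle `s` gives two coordinates that are constant when `e = 0`; in
  -- general their derivatives are `-e sin` and `e cos`.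
  have hp : ∀ s, HasDerivAt (fun s => f s * cos s - deriv f s * sin s) (-(e s * sin s)) s := by
    intro s
    refine (((hasDerivAt_of_contDiff hf s).mul (hasDerivAt_cos s)).sub
      ((hasDerivAt_of_contDiff hf' s).mul (hasDerivAt_sin s))).congr_deriv ?_
    rw [he2]
    ring
  have hq : ∀ s, HasDerivAt (fun s => f s * sin s + deriv f s * cos s) (e s * cos s) s := by
    intro s
    refine (((hasDerivAt_of_contDiff hf s).mul (hasDerivAt_sin s)).add
      ((hasDerivAt_of_contDiff hf' s).mul (hasDerivAt_cos s))).congr_deriv ?_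
    rw [he2]
    ring
  have key : ∀ g : ℝ → ℝ, Continuous g → (∀ s, |g s| ≤ 1) → ∀ x ∈ Icc 0 P,
      |∫ s in (0 : ℝ)..x, e s * g s| ≤ ∫ s in (0 : ℝ)..P, |e s| := by
    intro g hg hg1 x hx
    have hP : 0 ≤ P := hx.1.trans hx.2
    refine (abs_integral_le_of_mem (he.mul hg) (left_mem_Icc.2 hP) hx).trans ?_
    refine intervalIntegral.integral_mono_on hP ((he.mul hg).abs.intervalIntegrable _ _)
      (he.abs.intervalIntegrable _ _) fun s _ => ?_
    rw [Pi.mul_apply, abs_mul]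
    exact mul_le_of_le_one_right (abs_nonneg _) (hg1 s)
  -- The witnesses are the rotated coordinates at `0`. Rotating back adds two errors, each at most
  -- `∫ |e|`, hence the factor `2`.
  refine ⟨f 0, deriv f 0, fun x hx => ?_⟩
  have h1 := key _ continuous_sin.neg (fun s => by simpa using abs_sin_le_one s) x hx
  have h2 := key _ continuous_cos abs_cos_le_one x hx
  rw [intervalIntegral.integral_eq_sub_of_hasDerivAt
    (f' := fun s => e s * (-sin) s) (fun s _ => (hp s).congr_deriv (by simp))
    ((he.mul continuous_sin.neg).intervalIntegrable _ _)] at h1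
  rw [intervalIntegral.integral_eq_sub_of_hasDerivAt
    (f' := fun s => e s * cos s) (fun s _ => hq s)
    ((he.mul continuous_cos).intervalIntegrable _ _)] at h2
  simp only [cos_zero, sin_zero, mul_one, mul_zero, sub_zero, zero_add] at h1 h2
  have hcs := sin_sq_add_cos_sq x
  have hmul : ∀ {y z I : ℝ}, |y| ≤ I → |z| ≤ 1 → |y * z| ≤ I := fun {y z I} hy hz => by
    rw [abs_mul]
    exact (mul_le_of_le_one_right (abs_nonneg _) hz).trans hy
  have hc := abs_cos_le_one x
  have hs := abs_sin_le_one x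
  constructor
  · have e1 : f x - (f 0 * cos x + deriv f 0 * sin x) =
        (f x * cos x - deriv f x * sin x - f 0) * cos x +
          (f x * sin x + deriv f x * cos x - deriv f 0) * sin x := by
      linear_combination (-f x) * hcs
    rw [e1, two_mul]
    exact (abs_add_le _ _).trans (add_le_add (hmul h1 hc) (hmul h2 hs))
  · have e1 : deriv f x - (-f 0 * sin x + deriv f 0 * cos x) =
        (f x * sin x + deriv f x * cos x - deriv f 0) * cos x -
          (f x * cos x - deriv f x * sin x - f 0) * sin x := by
      linear_combination (-deriv f x) * hcs
    rw [e1, two_mul]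
    exact (abs_sub _ _).trans (add_le_add (hmul h2 hc) (hmul h1 hs))

theorem integral_cos_winding (w : ℕ) : ∫ x in (0 : ℝ)..(2 * w * π), cos x = 0 := by
  have : sin (2 * w * π) = 0 := by
    have := sin_nat_mul_pi (2 * w)
    push_cast at this
    exact this
  simp [integral_cos, this]

theorem cos_winding (w : ℕ) : cos (2 * w * π) = 1 := by
  have := cos_nat_mul_two_pi w
  rwa [← mul_assoc, mul_comm (w : ℝ) 2] at this

theorem integral_sin_winding (w : ℕ) : ∫ x in (0 : ℝ)..(2 * w * π), sin x = 0 := by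
  simp [integral_sin, cos_winding]

theorem integral_sq_kernel (w : ℕ) (a b : ℝ) :
    ∫ x in (0 : ℝ)..(2 * w * π), (a * cos x + b * sin x) ^ 2 = (a ^ 2 + b ^ 2) * (w * π) := by
  have hs : sin (2 * w * π) = 0 := by
    have := sin_nat_mul_pi (2 * w)
    push_cast at this
    exact this
  have hd : ∀ x ∈ uIcc (0 : ℝ) (2 * w * π), HasDerivAt
      (fun x => (a ^ 2 + b ^ 2) / 2 * x + (a ^ 2 - b ^ 2) / 2 * (sin x * cos x) +
        a * b * (sin x * sin x)) ((a * cos x + b * sin x) ^ 2) x := by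
    intro x _
    refine ((((hasDerivAt_id x).const_mul ((a ^ 2 + b ^ 2) / 2)).add
      (((hasDerivAt_sin x).mul (hasDerivAt_cos x)).const_mul ((a ^ 2 - b ^ 2) / 2))).add
      (((hasDerivAt_sin x).mul (hasDerivAt_sin x)).const_mul (a * b))).congr_deriv ?_
    linear_combination (-(a ^ 2 + b ^ 2) / 2) * sin_sq_add_cos_sq x
  rw [intervalIntegral.integral_eq_sub_of_hasDerivAt hd
    ((by fun_prop : Continuous _).intervalIntegrable _ _)]
  simp [hs]
  ring

/-- The closing condition controls the component of the curvature in the kernel of `∂² + 1`. -/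
theorem kernel_coeff_bound {w : ℕ} (hw : 1 ≤ w) {u k : ℝ → ℝ} {a b m ε M : ℝ}
    (hu : Continuous u) (hk : Continuous k) (hpos : ∀ x, 0 < u x) (huk : ∀ x, u x * k x = 1)
    (hcos : ∫ x in (0 : ℝ)..(2 * w * π), u x * cos x = 0)
    (hsin : ∫ x in (0 : ℝ)..(2 * w * π), u x * sin x = 0)
    (hM : ∫ x in (0 : ℝ)..(2 * w * π), u x ≤ M) (hm : 0 < m) (hε : ε ≤ 1)
    (hV : ∀ x ∈ Icc (0 : ℝ) (2 * w * π), |k x - m - (a * cos x + b * sin x)| ≤ ε) :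
    (|a| + |b|) ^ 2 ≤ (4 * M * (m + 1) + 4 * M ^ 2) * ε ^ 2 := by
  have hw' : (1 : ℝ) ≤ w := by exact_mod_cast hw
  have hP : 0 ≤ 2 * w * π := by positivity
  have hε0 : 0 ≤ ε := (abs_nonneg _).trans (hV 0 (left_mem_Icc.2 hP))
  set ℓ : ℝ → ℝ := fun x => a * cos x + b * sin x with hℓ
  have hℓc : Continuous ℓ := by fun_prop
  set R := |a| + |b| with hR
  have hR0 : 0 ≤ R := by positivity
  have hℓR : ∀ x, |ℓ x| ≤ R := fun x => by
    refine (abs_add_le _ _).trans (add_le_add ?_ ?_) <;> rw [abs_mul]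
    · exact mul_le_of_le_one_right (abs_nonneg _) (abs_cos_le_one x)
    · exact mul_le_of_le_one_right (abs_nonneg _) (abs_sin_le_one x)
  have huℓ : ∫ x in (0 : ℝ)..(2 * w * π), u x * ℓ x = 0 := by
    have : ∀ x, u x * ℓ x = a * (u x * cos x) + b * (u x * sin x) := fun x => by
      simp only [hℓ]; ring
    simp only [this]
    rw [intervalIntegral.integral_add ((by fun_prop : Continuous _).intervalIntegrable _ _)
      ((by fun_prop : Continuous _).intervalIntegrable _ _), intervalIntegral.integral_const_mul,
      intervalIntegral.integral_const_mul, hcos, hsin]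
    simp
  have hℓ0 : ∫ x in (0 : ℝ)..(2 * w * π), ℓ x = 0 := by
    simp only [hℓ]
    rw [intervalIntegral.integral_add ((by fun_prop : Continuous _).intervalIntegrable _ _)
      ((by fun_prop : Continuous _).intervalIntegrable _ _), intervalIntegral.integral_const_mul,
      intervalIntegral.integral_const_mul, integral_cos_winding, integral_sin_winding]
    simp
  -- Since `u k = 1`, the integrand is `ℓ - m u ℓ`, and both terms integrate to zero.
  have hzero : ∫ x in (0 : ℝ)..(2 * w * π), u x * (k x - m) * ℓ x = 0 := by
    have : ∀ x, u x * (k x - m) * ℓ x = ℓ x - m * (u x * ℓ x) := fun x => by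
      linear_combination (ℓ x) * huk x
    simp only [this]
    rw [intervalIntegral.integral_sub ((by fun_prop : Continuous _).intervalIntegrable _ _)
      ((by fun_prop : Continuous _).intervalIntegrable _ _), intervalIntegral.integral_const_mul,
      huℓ, hℓ0]
    simp
  -- Expand `u (k - m - ℓ)² ≤ ε² u`, drop `u (k - m)² ≥ 0`; the cross term is the vanishing integral
  -- `hzero`.
  have h1 : ∫ x in (0 : ℝ)..(2 * w * π), u x * ℓ x ^ 2 ≤ ε ^ 2 * M := by
    have h2 : ∫ x in (0 : ℝ)..(2 * w * π), u x * ℓ x ^ 2 ≤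
        ∫ x in (0 : ℝ)..(2 * w * π), (ε ^ 2 * u x + 2 * (u x * (k x - m) * ℓ x)) := by
      refine intervalIntegral.integral_mono_on hP
        ((by fun_prop : Continuous _).intervalIntegrable _ _)
        ((by fun_prop : Continuous _).intervalIntegrable _ _) fun x hx => ?_
      have h3 : (k x - m - ℓ x) ^ 2 ≤ ε ^ 2 := by
        rw [← sq_abs]
        exact pow_le_pow_left₀ (abs_nonneg _) (hV x hx) 2
      have h4 := mul_le_mul_of_nonneg_left h3 (hpos x).le
      have h5 := mul_nonneg (hpos x).le (sq_nonneg (k x - m))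
      linarith
    rw [intervalIntegral.integral_add ((by fun_prop : Continuous _).intervalIntegrable _ _)
      ((by fun_prop : Continuous _).intervalIntegrable _ _), intervalIntegral.integral_const_mul,
      intervalIntegral.integral_const_mul, hzero] at h2
    have := mul_le_mul_of_nonneg_left hM (sq_nonneg ε)
    linarith
  -- Remove the weight by writing `ℓ² = k (u ℓ²)` with `k ≤ m + R + ε`. The `R` on the right is
  -- absorbed in `h12`, where `ε ≤ 1` turns `ε⁴` into `ε²`.
  have h6 : (a ^ 2 + b ^ 2) * (w * π) ≤ (m + R + ε) * (ε ^ 2 * M) := by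
    rw [← integral_sq_kernel]
    calc ∫ x in (0 : ℝ)..(2 * w * π), ℓ x ^ 2
        ≤ ∫ x in (0 : ℝ)..(2 * w * π), (m + R + ε) * (u x * ℓ x ^ 2) := by
          refine intervalIntegral.integral_mono_on hP
            ((by fun_prop : Continuous _).intervalIntegrable _ _)
            ((by fun_prop : Continuous _).intervalIntegrable _ _) fun x hx => ?_
          have h7 : k x ≤ m + R + ε := by
            have := (abs_le.1 (hV x hx)).2
            have := (abs_le.1 (hℓR x)).2
            simp only [hℓ] at this
            linarith
          calc ℓ x ^ 2 = k x * (u x * ℓ x ^ 2) := by linear_combination (-ℓ x ^ 2) * huk x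
            _ ≤ _ := mul_le_mul_of_nonneg_right h7
              (mul_nonneg (hpos x).le (sq_nonneg _))
      _ = (m + R + ε) * ∫ x in (0 : ℝ)..(2 * w * π), u x * ℓ x ^ 2 :=
          intervalIntegral.integral_const_mul _ _
      _ ≤ _ := mul_le_mul_of_nonneg_left h1 (by positivity)
  have hM0 : 0 ≤ M :=
    (intervalIntegral.integral_nonneg hP fun x _ => (hpos x).le).trans hM
  have h8 : R ^ 2 ≤ 2 * ((a ^ 2 + b ^ 2) * (w * π)) := by
    have h9 : R ^ 2 ≤ 2 * (a ^ 2 + b ^ 2) := by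
      rw [hR, ← sq_abs a, ← sq_abs b]
      nlinarith [sq_nonneg (|a| - |b|)]
    have h10 : (1 : ℝ) ≤ w * π := by nlinarith [pi_gt_three]
    nlinarith [sq_nonneg a, sq_nonneg b]
  have h11 : (m + R + ε) * (ε ^ 2 * M) ≤ (m + 1) * (ε ^ 2 * M) + R * (ε ^ 2 * M) := by
    nlinarith [mul_nonneg (sq_nonneg ε) hM0]
  have h12 : R * (ε ^ 2 * M) ≤ R ^ 2 / 4 + ε ^ 2 * M ^ 2 := by
    have h13 : ε ^ 4 ≤ ε ^ 2 := pow_le_pow_of_le_one hε0 hε (by norm_num)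
    nlinarith [sq_nonneg (R / 2 - ε ^ 2 * M), mul_le_mul_of_nonneg_right h13 (sq_nonneg M)]
  nlinarith

/-! ### Decay of the distance to the circle and of the speed -/

namespace SupportFlow

variable {w : ℕ} {c t : ℝ} {h : ℝ → ℝ → ℝ}

theorem smooth_radius (hf : SupportFlow w c h) : SmoothFamily (radius h) :=
  (hf.smooth.iteratedDeriv 2).add hf.smooth

theorem smooth_curv (hf : SupportFlow w c h) : SmoothFamily (curv h) :=
  hf.smooth_radius.inv fun t ht θ => (hf.radius_pos t ht θ).ne'

theorem smooth_speed (hf : SupportFlow w c h) : SmoothFamily (speed c h) :=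
  hf.smooth.of_hasDerivAt hf.evolution

theorem periodic_radius (hf : SupportFlow w c h) (ht : 0 < t) :
    Function.Periodic (radius h t) (2 * w * π) :=
  (periodic_iteratedDeriv (hf.periodic t ht) 2).add (hf.periodic t ht)

theorem periodic_curv (hf : SupportFlow w c h) (ht : 0 < t) :
    Function.Periodic (curv h t) (2 * w * π) := fun θ => by
  simp only [curv, hf.periodic_radius ht θ]

theorem periodic_speed (hf : SupportFlow w c h) (ht : 0 < t) :
    Function.Periodic (speed c h t) (2 * w * π) := fun θ => by
  simp only [speed, periodic_iteratedDeriv (hf.periodic_curv ht) 2 θ, hf.periodic_curv ht θ,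
    hf.periodic t ht θ]

theorem radius_mul_curv (hf : SupportFlow w c h) (ht : 0 < t) (θ : ℝ) :
    radius h t θ * curv h t θ = 1 :=
  mul_inv_cancel₀ (hf.radius_pos t ht θ).ne'

theorem curv_pos (hf : SupportFlow w c h) (ht : 0 < t) (θ : ℝ) : 0 < curv h t θ :=
  inv_pos.2 (hf.radius_pos t ht θ)

theorem iteratedDeriv_two_sub_const (f : ℝ → ℝ) (a : ℝ) :
    iteratedDeriv 2 (fun x => f x - a) = iteratedDeriv 2 f := by
  simp only [iteratedDeriv_succ, iteratedDeriv_zero, deriv_sub_const_fun]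

/-- The squared `L²` distance to the stationary circle decays exponentially. -/
theorem integral_sq_sub_decay (hf : SupportFlow w c h) (hc : 0 < c) :
    ∃ C, ∀ᶠ t in atTop,
      ∫ θ in (0 : ℝ)..(2 * w * π), (h t θ - (√c)⁻¹) ^ 2 ≤ C * exp (-2 * c * t) := by
  have hsc : 0 < √c := sqrt_pos.2 hc
  have hP : 0 ≤ 2 * w * π := by positivity
  refine exists_exp_decay (E' := fun t => ∫ θ in (0 : ℝ)..(2 * w * π),
    2 * ((h t θ - (√c)⁻¹) * speed c h t θ)) ?_ ?_
  · filter_upwards [eventually_gt_atTop 0] with t ht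
    exact (hf.smooth.sub (SmoothFamily.const _)).hasDerivAt_integral_sq
      (fun t ht θ => (hf.evolution t ht θ).sub_const _) _ _ ht
  · filter_upwards [eventually_gt_atTop 0] with t ht
    have hh := hf.smooth.slice ht
    have hk := hf.smooth_curv.slice ht
    have hu := hf.smooth_radius.slice ht
    have hk2 := contDiff_iteratedDeriv hk 2
    have hcr : c * (√c)⁻¹ = √c := by
      rw [← div_eq_mul_inv, div_sqrt]
    have hg : ContDiff ℝ ∞ fun x => h t x - (√c)⁻¹ := hh.sub contDiff_const
    have hκ : ContDiff ℝ ∞ fun x => curv h t x - √c := hk.sub contDiff_const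
    have hsa := integral_mul_iteratedDeriv_two_add hg hκ
      (fun x => congrArg (· - (√c)⁻¹) (hf.periodic t ht x))
      (fun x => congrArg (· - √c) (hf.periodic_curv ht x))
    simp only [iteratedDeriv_two_sub_const] at hsa
    have hnonpos : ∫ x in (0 : ℝ)..(2 * w * π),
        (iteratedDeriv 2 (h t) x + (h t x - (√c)⁻¹)) * (curv h t x - √c) ≤ 0 := by
      rw [← neg_nonneg, ← intervalIntegral.integral_neg]
      refine intervalIntegral.integral_nonneg hP fun x _ => ?_
      have hu0 := hf.radius_pos t ht x
      have e1 : iteratedDeriv 2 (h t) x + (h t x - (√c)⁻¹) = radius h t x - (√c)⁻¹ := by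
        simp only [radius]; ring
      rw [e1, curv]
      -- Monotonicity of the reciprocal: `-(u - r)(1/u - 1/r) = (u - r)² / (u r)` with `1/r = √c`.
      have e2 : -((radius h t x - (√c)⁻¹) * ((radius h t x)⁻¹ - √c)) =
          (radius h t x - (√c)⁻¹) ^ 2 * √c * (radius h t x)⁻¹ := by
        field_simp
        ring
      rw [e2]
      positivity
    have hsplit : ∀ x, 2 * ((h t x - (√c)⁻¹) * speed c h t x) =
        2 * ((h t x - (√c)⁻¹) * (iteratedDeriv 2 (curv h t) x + (curv h t x - √c))) +
          (-2 * c) * (h t x - (√c)⁻¹) ^ 2 := fun x => by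
      simp only [speed]
      linear_combination (-2 * (h t x - (√c)⁻¹)) * hcr
    have hhc := hh.continuous
    have hkc := hk.continuous
    have hk2c := hk2.continuous
    simp only [hsplit]
    rw [intervalIntegral.integral_add ((by fun_prop : Continuous _).intervalIntegrable _ _)
      ((by fun_prop : Continuous _).intervalIntegrable _ _), intervalIntegral.integral_const_mul,
      intervalIntegral.integral_const_mul, hsa]
    linarith

theorem hasDerivAt_radius (hf : SupportFlow w c h) (ht : 0 < t) (θ : ℝ) :
    HasDerivAt (fun s => radius h s θ) (radius (speed c h) t θ) t :=
  (hf.smooth.hasDerivAt_iteratedDeriv hf.evolution 2 t ht θ).add (hf.evolution t ht θ)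

theorem hasDerivAt_curv (hf : SupportFlow w c h) (ht : 0 < t) (θ : ℝ) :
    HasDerivAt (fun s => curv h s θ) (-(curv h t θ ^ 2 * radius (speed c h) t θ)) t := by
  refine ((hf.hasDerivAt_radius ht θ).inv (hf.radius_pos t ht θ).ne').congr_deriv ?_
  simp only [curv]
  field_simp

/-- The squared `L²` norm of the time derivative decays exponentially. -/
theorem integral_sq_speed_decay (hf : SupportFlow w c h) :
    ∃ C, ∀ᶠ t in atTop,
      ∫ θ in (0 : ℝ)..(2 * w * π), speed c h t θ ^ 2 ≤ C * exp (-2 * c * t) := by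
  have hP : 0 ≤ 2 * w * π := by positivity
  set kt : ℝ → ℝ → ℝ := fun t θ => -(curv h t θ ^ 2 * radius (speed c h) t θ) with hkt
  have hkt' : ∀ t, 0 < t → ∀ θ, HasDerivAt (fun s => curv h s θ) (kt t θ) t :=
    fun t ht θ => hf.hasDerivAt_curv ht θ
  have hktS : SmoothFamily kt := hf.smooth_curv.of_hasDerivAt hkt'
  have hev : ∀ t, 0 < t → ∀ θ, HasDerivAt (fun s => speed c h s θ)
      (iteratedDeriv 2 (kt t) θ + kt t θ - c * speed c h t θ) t := fun t ht θ =>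
    ((hf.smooth_curv.hasDerivAt_iteratedDeriv hkt' 2 t ht θ).add (hkt' t ht θ)).sub
      ((hf.evolution t ht θ).const_mul c)
  refine exists_exp_decay (E' := fun t => ∫ θ in (0 : ℝ)..(2 * w * π),
    2 * (speed c h t θ * (iteratedDeriv 2 (kt t) θ + kt t θ - c * speed c h t θ))) ?_ ?_
  · filter_upwards [eventually_gt_atTop 0] with t ht
    exact hf.smooth_speed.hasDerivAt_integral_sq hev _ _ ht
  · filter_upwards [eventually_gt_atTop 0] with t ht
    have hs := hf.smooth_speed.slice ht
    have hk := hktS.slice ht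
    have hsP := hf.periodic_speed ht
    have hkP : Function.Periodic (kt t) (2 * w * π) := fun x => by
      simp only [hkt, radius, hf.periodic_curv ht x, periodic_iteratedDeriv hsP 2 x, hsP x]
    have hsa := integral_mul_iteratedDeriv_two_add hs hk hsP hkP
    have hnonpos : ∫ x in (0 : ℝ)..(2 * w * π),
        (iteratedDeriv 2 (speed c h t) x + speed c h t x) * kt t x ≤ 0 := by
      rw [← neg_nonneg, ← intervalIntegral.integral_neg]
      refine intervalIntegral.integral_nonneg hP fun x _ => ?_
      -- With `v` the speed, `k_t = -k² (v'' + v)`, so the pairing is minus the square of `k (v'' +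
      -- v)`.
      have e2 : -((iteratedDeriv 2 (speed c h t) x + speed c h t x) * kt t x) =
          (curv h t x * radius (speed c h) t x) ^ 2 := by
        simp only [hkt, radius]
        ring
      rw [e2]
      positivity
    have hsplit : ∀ x, 2 * (speed c h t x *
        (iteratedDeriv 2 (kt t) x + kt t x - c * speed c h t x)) =
        2 * (speed c h t x * (iteratedDeriv 2 (kt t) x + kt t x)) +
          (-2 * c) * speed c h t x ^ 2 := fun x => by
      ring
    have hsc := hs.continuous
    have hkc := hk.continuous
    have hk2c := (contDiff_iteratedDeriv hk 2).continuous
    simp only [hsplit]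
    rw [intervalIntegral.integral_add ((by fun_prop : Continuous _).intervalIntegrable _ _)
      ((by fun_prop : Continuous _).intervalIntegrable _ _), intervalIntegral.integral_const_mul,
      intervalIntegral.integral_const_mul, hsa]
    linarith

end SupportFlow

/-! ### Energies of derivatives and product estimates -/

open Asymptotics

theorem isBigO_of_le_mul {f g : ℝ → ℝ} (C : ℝ) (hf : ∀ t, 0 ≤ f t)
    (hfg : ∀ᶠ t in atTop, f t ≤ C * g t) : f =O[atTop] g := by
  refine IsBigO.of_bound |C| ?_
  filter_upwards [hfg] with t ht
  rw [norm_of_nonneg (hf t), norm_eq_abs, ← abs_mul]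
  exact ht.trans (le_abs_self _)

theorem exists_le_mul_of_isBigO {f g : ℝ → ℝ} (hg : ∀ t, 0 ≤ g t) (hfg : f =O[atTop] g) :
    ∃ C, 0 ≤ C ∧ ∀ᶠ t in atTop, f t ≤ C * g t := by
  obtain ⟨C, hC0, hC⟩ := hfg.exists_nonneg
  refine ⟨C, hC0, ?_⟩
  filter_upwards [hC.bound] with t ht
  rw [norm_of_nonneg (hg t)] at ht
  exact (le_abs_self _).trans ht

/-- The squared `L²` norm over a period of the `n`-th derivative. -/
def energy (P : ℝ) (F : ℝ → ℝ → ℝ) (n : ℕ) (t : ℝ) : ℝ :=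
  ∫ θ in (0 : ℝ)..P, iteratedDeriv n (F t) θ ^ 2

section Energy

variable {P : ℝ} {F G : ℝ → ℝ → ℝ}

theorem energy_nonneg (hP : 0 < P) (F : ℝ → ℝ → ℝ) (n : ℕ) (t : ℝ) : 0 ≤ energy P F n t :=
  intervalIntegral.integral_nonneg hP.le fun _ _ => sq_nonneg _

/-- Poincaré inequality; `1 ≤ n` is essential, since constants violate it at order `0`. -/
theorem energy_isBigO_succ (hP : 0 < P) (hF : SmoothFamily F)
    (hFP : ∀ t, 0 < t → Function.Periodic (F t) P) {n : ℕ} (hn : 1 ≤ n) :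
    energy P F n =O[atTop] energy P F (n + 1) := by
  refine isBigO_of_le_mul (P ^ 2) (energy_nonneg hP F n) ?_
  filter_upwards [eventually_gt_atTop 0] with t ht
  obtain ⟨m, rfl⟩ := Nat.exists_eq_add_of_le' hn
  have := integral_sq_deriv_le hP (contDiff_iteratedDeriv (hF.slice ht) m)
    (periodic_iteratedDeriv (hFP t ht) m)
  simpa only [energy, iteratedDeriv_succ] using this

theorem energy_isBigO_of_le (hP : 0 < P) (hF : SmoothFamily F)
    (hFP : ∀ t, 0 < t → Function.Periodic (F t) P) {n m : ℕ} (hn : 1 ≤ n) (hnm : n ≤ m) :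
    energy P F n =O[atTop] energy P F m := by
  induction m, hnm using Nat.le_induction with
  | base => exact isBigO_refl _ _
  | succ m hm ih => exact ih.trans (energy_isBigO_succ hP hF hFP (hn.trans hm))

theorem sq_iteratedDeriv_le_energy (hP : 0 < P) (hF : SmoothFamily F)
    (hFP : ∀ t, 0 < t → Function.Periodic (F t) P) {n : ℕ} (hn : 1 ≤ n) {t : ℝ} (ht : 0 < t)
    (θ : ℝ) : iteratedDeriv n (F t) θ ^ 2 ≤ P * energy P F (n + 1) t := by
  obtain ⟨m, rfl⟩ := Nat.exists_eq_add_of_le' hn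
  have := sq_deriv_le_integral hP (contDiff_iteratedDeriv (hF.slice ht) m)
    (periodic_iteratedDeriv (hFP t ht) m) θ
  simpa only [energy, iteratedDeriv_succ] using this

/-- The first factor is taken in sup norm, at the cost of one more derivative, and the second in
`L²`. -/
theorem integral_sq_mul_le_energy (hP : 0 < P) (hF : SmoothFamily F) (hG : SmoothFamily G)
    (hFP : ∀ t, 0 < t → Function.Periodic (F t) P) {n : ℕ} (hn : 1 ≤ n) (m : ℕ) {t : ℝ}
    (ht : 0 < t) :
    ∫ θ in (0 : ℝ)..P, (iteratedDeriv n (F t) θ * iteratedDeriv m (G t) θ) ^ 2 ≤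
      P * (energy P F (n + 1) t * energy P G m t) := by
  have h1 := (contDiff_iteratedDeriv (hF.slice ht) n).continuous
  have h2 := (contDiff_iteratedDeriv (hG.slice ht) m).continuous
  rw [← mul_assoc]
  nth_rw 2 [energy]
  rw [← intervalIntegral.integral_const_mul]
  refine intervalIntegral.integral_mono_on hP.le
    ((by fun_prop : Continuous _).intervalIntegrable _ _)
    ((by fun_prop : Continuous _).intervalIntegrable _ _) fun θ _ => ?_
  rw [mul_pow]
  exact mul_le_mul_of_nonneg_right (sq_iteratedDeriv_le_energy hP hF hFP hn ht θ) (sq_nonneg _)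

theorem integral_sq_mul_isBigO (hP : 0 < P) (hF : SmoothFamily F) (hG : SmoothFamily G)
    (hFP : ∀ t, 0 < t → Function.Periodic (F t) P) {n : ℕ} (hn : 1 ≤ n) (m : ℕ) :
    (fun t => ∫ θ in (0 : ℝ)..P, (iteratedDeriv n (F t) θ * iteratedDeriv m (G t) θ) ^ 2)
      =O[atTop] fun t => energy P F (n + 1) t * energy P G m t := by
  refine isBigO_of_le_mul P
    (fun t => intervalIntegral.integral_nonneg hP.le fun _ _ => sq_nonneg _) ?_
  filter_upwards [eventually_gt_atTop 0] with t ht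
    using integral_sq_mul_le_energy hP hF hG hFP hn m ht

/-- Products of derivatives of total order `n`, neither factor being undifferentiated, are
controlled by derivatives of order `n - 1` as soon as the lower derivatives are bounded. -/
theorem integral_sq_mul_isBigO_energy (hP : 0 < P) (hF : SmoothFamily F) (hG : SmoothFamily G)
    (hFP : ∀ t, 0 < t → Function.Periodic (F t) P) (hGP : ∀ t, 0 < t → Function.Periodic (G t) P)
    {n : ℕ} (hFG : ∀ i, 1 ≤ i → i < n → energy P F i =O[atTop] energy P G i)
    (hF1 : ∀ i, 1 ≤ i → i ≤ max 2 (n / 2) → energy P F i =O[atTop] (1 : ℝ → ℝ))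
    (hG1 : ∀ i, 1 ≤ i → i ≤ max 2 (n / 2) → energy P G i =O[atTop] (1 : ℝ → ℝ))
    {j : ℕ} (hj : 1 ≤ j) (hjn : j < n) :
    (fun t => ∫ θ in (0 : ℝ)..P, (iteratedDeriv j (F t) θ * iteratedDeriv (n - j) (G t) θ) ^ 2)
      =O[atTop] energy P G (n - 1) := by
  have hGn : ∀ i, 1 ≤ i → i < n → energy P G i =O[atTop] energy P G (n - 1) := fun i hi hin =>
    energy_isBigO_of_le hP hG hGP hi (by omega)
  have hFn : ∀ i, 1 ≤ i → i < n → energy P F i =O[atTop] energy P G (n - 1) := fun i hi hin =>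
    (hFG i hi hin).trans (hGn i hi hin)
  have hleft : ∀ {a b : ℝ → ℝ}, a =O[atTop] (1 : ℝ → ℝ) → b =O[atTop] energy P G (n - 1) →
      (fun t => a t * b t) =O[atTop] energy P G (n - 1) := fun {a b} ha hb => by
    simpa using ha.mul hb
  have hright : ∀ {a b : ℝ → ℝ}, a =O[atTop] energy P G (n - 1) → b =O[atTop] (1 : ℝ → ℝ) →
      (fun t => a t * b t) =O[atTop] energy P G (n - 1) := fun {a b} ha hb => by
    simpa using ha.mul hb
  have hFsup := integral_sq_mul_isBigO hP hF hG hFP hj (n - j)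
  have hGsup := integral_sq_mul_isBigO hP hG hF hGP (n := n - j) (by omega) j
  simp only [mul_comm (iteratedDeriv (n - j) (G _) _)] at hGsup
  -- The factor of lower order should be the bounded one. If its order is `1`, its sup norm is
  -- bounded by the energy of order `2`. Otherwise it is taken in `L²`, and the sup norm of the
  -- other factor costs one derivative, which still has order at most `n - 1`.
  rcases le_or_gt (2 * j) n with hjs | hjl
  · rcases hj.eq_or_lt with rfl | hj2
    · exact hFsup.trans (hleft (hF1 2 (by omega) (by omega)) (hGn _ (by omega) (by omega)))
    · exact hGsup.trans (hright (hGn _ (by omega) (by omega)) (hF1 j hj (by omega)))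
  · rcases (show 1 ≤ n - j by omega).eq_or_lt with hi | hi
    · rw [← hi] at hGsup hFsup ⊢
      exact hGsup.trans (hleft (hG1 2 (by omega) (by omega)) (hFn j hj hjn))
    · exact hFsup.trans (hright (hFn _ (by omega) (by omega)) (hG1 _ (by omega) (by omega)))

end Energy

/-- The mixed terms in the Leibniz rule for the `n`-th derivative of curvature times radius. -/
def mixedTerms (h : ℝ → ℝ → ℝ) (n : ℕ) (t θ : ℝ) : ℝ :=
  ∑ j ∈ Finset.Ico 1 n, (n.choose j : ℝ) * iteratedDeriv j (curv h t) θ *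
    iteratedDeriv (n - j) (radius h t) θ

theorem winding_period_pos {w : ℕ} (hw : 1 ≤ w) : (0 : ℝ) < 2 * w * π := by
  have : (1 : ℝ) ≤ w := by exact_mod_cast hw
  positivity

/-! ### Convergence of the curvature in `C¹` -/

namespace SupportFlow

variable {w : ℕ} {c t : ℝ} {h : ℝ → ℝ → ℝ}

/-- The curvature converges in `C¹` to its stationary value. -/
theorem curv_convergence (hf : SupportFlow w c h) (hw : 1 ≤ w) (hc : 0 < c) :
    ∃ B : ℝ → ℝ, Tendsto B atTop (𝓝 0) ∧ ∀ᶠ t in atTop, ∀ θ,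
      |curv h t θ - √c| ≤ B t ∧ |deriv (curv h t) θ| ≤ B t := by
  obtain ⟨C₁, hC₁⟩ := hf.integral_sq_sub_decay hc
  obtain ⟨C₂, hC₂⟩ := hf.integral_sq_speed_decay
  have hsc : 0 < √c := sqrt_pos.2 hc
  have hP := winding_period_pos hw
  set P : ℝ := 2 * w * π with hPdef
  have hcr : c * (√c)⁻¹ = √c := by rw [← div_eq_mul_inv, div_sqrt]
  -- `C` comes from Cauchy–Schwarz and `(x + y)² ≤ 2x² + 2y²`, `M` bounds the length `∫ u`, and `D`
  -- is the square root of the constant in `kernel_coeff_bound`.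
  set C : ℝ := P * (2 * |C₂| + 2 * c ^ 2 * |C₁|) with hC
  set M : ℝ := P * |C₁| + 1 + P * (√c)⁻¹ with hM
  have hC0 : 0 ≤ C := by positivity
  have hM0 : 0 ≤ M := by positivity
  set D : ℝ := √(4 * M * (√c + 1) + 4 * M ^ 2) with hD
  set ε : ℝ → ℝ := fun t => 2 * (√C * exp (-c * t)) with hε
  have hexp : Tendsto (fun t => exp (-c * t)) atTop (𝓝 0) :=
    tendsto_exp_atBot.comp (tendsto_id.const_mul_atTop_of_neg (neg_lt_zero.2 hc))
  have hε0 : Tendsto ε atTop (𝓝 0) := by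
    have := (hexp.const_mul (√C)).const_mul 2
    simpa only [mul_zero] using this
  refine ⟨fun t => ε t + D * ε t, by simpa using hε0.add (hε0.const_mul D), ?_⟩
  filter_upwards [hC₁, hC₂, eventually_gt_atTop 0, hε0.eventually (ge_mem_nhds zero_lt_one)]
    with t h1 h2 ht hε1
  have hh := hf.smooth.slice ht
  have hk := hf.smooth_curv.slice ht
  have hu := hf.smooth_radius.slice ht
  have hs := hf.smooth_speed.slice ht
  have hhc := hh.continuous
  have hsc' := hs.continuous
  have huc := hu.continuous
  have hκ : ContDiff ℝ ∞ fun x => curv h t x - √c := hk.sub contDiff_const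
  obtain ⟨a, b, hab⟩ := exists_kernel_approx (P := P) hκ
  have he : ∀ x, iteratedDeriv 2 (fun x => curv h t x - √c) x + (curv h t x - √c) =
      speed c h t x + c * (h t x - (√c)⁻¹) := fun x => by
    rw [iteratedDeriv_two_sub_const]
    simp only [speed]
    linear_combination hcr
  simp only [he, deriv_sub_const_fun] at hab
  have hexp1 : exp (-2 * c * t) ≤ 1 := exp_le_one_iff.2 (by nlinarith)
  have hE : 2 * ∫ s in (0 : ℝ)..P, |speed c h t s + c * (h t s - (√c)⁻¹)| ≤ ε t := by
    simp only [hε]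
    gcongr
    have hsq := sq_integral_le hP (f := fun s => |speed c h t s + c * (h t s - (√c)⁻¹)|)
      (by fun_prop)
    simp only [sq_abs] at hsq
    have hint : ∫ s in (0 : ℝ)..P, (speed c h t s + c * (h t s - (√c)⁻¹)) ^ 2 ≤
        ∫ s in (0 : ℝ)..P, (2 * speed c h t s ^ 2 + 2 * c ^ 2 * (h t s - (√c)⁻¹) ^ 2) := by
      refine intervalIntegral.integral_mono_on hP.le
        ((by fun_prop : Continuous _).intervalIntegrable _ _)
        ((by fun_prop : Continuous _).intervalIntegrable _ _) fun s _ => ?_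
      nlinarith [sq_nonneg (speed c h t s - c * (h t s - (√c)⁻¹))]
    rw [intervalIntegral.integral_add ((by fun_prop : Continuous _).intervalIntegrable _ _)
      ((by fun_prop : Continuous _).intervalIntegrable _ _), intervalIntegral.integral_const_mul,
      intervalIntegral.integral_const_mul] at hint
    refine abs_le_of_sq_le_sq' ?_ (by positivity) |>.2
    refine hsq.trans ?_
    rw [mul_pow, sq_sqrt hC0, ← exp_nat_mul, hC, mul_assoc P]
    refine mul_le_mul_of_nonneg_left (hint.trans ?_) hP.le
    have e1 : (2 : ℕ) * (-c * t) = -2 * c * t := by push_cast; ring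
    rw [e1]
    have h1' := h1.trans (mul_le_mul_of_nonneg_right (le_abs_self C₁) (exp_pos _).le)
    have h2' := h2.trans (mul_le_mul_of_nonneg_right (le_abs_self C₂) (exp_pos _).le)
    have h1'' := mul_le_mul_of_nonneg_left h1' (by positivity : (0 : ℝ) ≤ 2 * c ^ 2)
    linarith
  have hab' : ∀ x ∈ Icc 0 P, |curv h t x - √c - (a * cos x + b * sin x)| ≤ ε t ∧
      |deriv (curv h t) x - (-a * sin x + b * cos x)| ≤ ε t := fun x hx =>
    ⟨(hab x hx).1.trans hE, (hab x hx).2.trans hE⟩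
  have hεt : 0 ≤ ε t := by simp only [hε]; positivity
  -- Closing condition: `u = (∂² + 1) h` is orthogonal to the periodic kernel of the self-adjoint
  -- operator `∂² + 1`.
  have hclose : ∀ g : ℝ → ℝ, ContDiff ℝ ∞ g → Function.Periodic g P →
      (∀ x, iteratedDeriv 2 g x + g x = 0) → ∫ x in (0 : ℝ)..P, radius h t x * g x = 0 := by
    intro g hg hgP hg0
    have := integral_mul_iteratedDeriv_two_add hg hh hgP (hf.periodic t ht)
    simp only [hg0, zero_mul, intervalIntegral.integral_zero] at this
    refine Eq.trans (intervalIntegral.integral_congr fun x _ => ?_) this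
    exact mul_comm _ _
  have hperiod : ∀ g : ℝ → ℝ, Function.Periodic g (2 * π) → Function.Periodic g P := by
    intro g hg
    have := hg.nat_mul w
    rwa [← mul_assoc, mul_comm (w : ℝ) 2] at this
  have hcos := hclose cos contDiff_cos (hperiod _ cos_periodic) fun x => by
    simp [iteratedDeriv_succ]
  have hsin := hclose sin contDiff_sin (hperiod _ sin_periodic) fun x => by
    simp [iteratedDeriv_succ]
  have hmass : ∫ x in (0 : ℝ)..P, radius h t x ≤ M := by
    have h3 := integral_mul_iteratedDeriv_two_add (P := P) (f := fun _ => 1) contDiff_const hh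
      (fun _ => rfl) (hf.periodic t ht)
    simp only [one_mul, iteratedDeriv_succ, iteratedDeriv_zero, deriv_const', deriv_const,
      zero_add] at h3
    have h4 : ∫ x in (0 : ℝ)..P, radius h t x = ∫ x in (0 : ℝ)..P, h t x := by
      rw [← h3]
      simp only [radius, iteratedDeriv_succ, iteratedDeriv_zero]
    have h5 := sq_integral_le hP (f := fun x => h t x - (√c)⁻¹) (by fun_prop)
    rw [intervalIntegral.integral_sub ((by fun_prop : Continuous _).intervalIntegrable _ _)
      ((by fun_prop : Continuous _).intervalIntegrable _ _)] at h5
    simp only [intervalIntegral.integral_const, smul_eq_mul, sub_zero] at h5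
    have h6 : ∫ θ in (0 : ℝ)..P, (h t θ - (√c)⁻¹) ^ 2 ≤ |C₁| :=
      h1.trans ((mul_le_mul_of_nonneg_right (le_abs_self C₁) (exp_pos _).le).trans
        (mul_le_of_le_one_right (abs_nonneg _) hexp1))
    have h7 := mul_le_mul_of_nonneg_left h6 hP.le
    rw [h4, hM]
    -- For `y = ∫ h - P/√c` one has `y² ≤ P |C₁|` and `2y ≤ y² + 1`, whence `y ≤ P |C₁| + 1`.
    nlinarith [sq_nonneg ((∫ x in (0 : ℝ)..P, h t x) - P * (√c)⁻¹ - 1)]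
  have hR := kernel_coeff_bound hw hu.continuous hk.continuous (hf.radius_pos t ht)
    (hf.radius_mul_curv ht) hcos hsin hmass hsc hε1 fun x hx => (hab' x hx).1
  have hR' : |a| + |b| ≤ D * ε t := by
    refine abs_le_of_sq_le_sq' ?_ (by positivity) |>.2
    rwa [mul_pow, hD, sq_sqrt (by positivity)]
  have htrig : ∀ {y z : ℝ} (p q : ℝ), |y| ≤ 1 → |z| ≤ 1 → |p * y + q * z| ≤ |p| + |q| :=
    fun {y z} p q hy hz => by
      refine (abs_add_le _ _).trans (add_le_add ?_ ?_) <;> rw [abs_mul]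
      · exact mul_le_of_le_one_right (abs_nonneg _) hy
      · exact mul_le_of_le_one_right (abs_nonneg _) hz
  intro θ
  obtain ⟨y, hy, hθy⟩ := exists_mem_Icc_periodic hP θ
  rw [hθy _ (hf.periodic_curv ht), hθy _ (periodic_deriv (hf.periodic_curv ht))]
  obtain ⟨h8, h9⟩ := hab' y hy
  have h10 := htrig a b (abs_cos_le_one y) (abs_sin_le_one y)
  have h11 := htrig (-a) b (abs_sin_le_one y) (abs_cos_le_one y)
  rw [abs_neg] at h11
  rw [abs_le] at h8 h9 h10 h11 ⊢
  rw [abs_le]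
  refine ⟨⟨?_, ?_⟩, ?_, ?_⟩ <;> linarith

end SupportFlow

/-! ### Low-order bounds and the mixed terms -/

theorem integral_sq_isBigO_of_le_add {P : ℝ} (hP : 0 < P) {X Y Z : ℝ → ℝ → ℝ} {g : ℝ → ℝ} (C : ℝ)
    (hX : SmoothFamily X) (hY : SmoothFamily Y) (hZ : SmoothFamily Z)
    (hle : ∀ᶠ t in atTop, ∀ θ, X t θ ^ 2 ≤ C * (Y t θ ^ 2 + Z t θ ^ 2))
    (hYg : (fun t => ∫ θ in (0 : ℝ)..P, Y t θ ^ 2) =O[atTop] g)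
    (hZg : (fun t => ∫ θ in (0 : ℝ)..P, Z t θ ^ 2) =O[atTop] g) :
    (fun t => ∫ θ in (0 : ℝ)..P, X t θ ^ 2) =O[atTop] g := by
  refine (isBigO_of_le_mul C
    (fun t => intervalIntegral.integral_nonneg hP.le fun _ _ => sq_nonneg _) ?_).trans
    (hYg.add hZg)
  filter_upwards [hle, eventually_gt_atTop 0] with t h1 ht
  have hXc := (hX.slice ht).continuous
  have hYc := (hY.slice ht).continuous
  have hZc := (hZ.slice ht).continuous
  rw [← intervalIntegral.integral_add ((by fun_prop : Continuous _).intervalIntegrable _ _)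
    ((by fun_prop : Continuous _).intervalIntegrable _ _), ← intervalIntegral.integral_const_mul]
  exact intervalIntegral.integral_mono_on hP.le
    ((by fun_prop : Continuous _).intervalIntegrable _ _)
    ((by fun_prop : Continuous _).intervalIntegrable _ _) fun θ _ => h1 θ

theorem iteratedDeriv_two_iteratedDeriv (f : ℝ → ℝ) (n : ℕ) :
    iteratedDeriv 2 (iteratedDeriv n f) = iteratedDeriv n (iteratedDeriv 2 f) := by
  simp only [iteratedDeriv_eq_iterate, ← Function.iterate_add_apply, add_comm]

namespace SupportFlow

variable {w : ℕ} {c t : ℝ} {h : ℝ → ℝ → ℝ}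

theorem smooth_mixedTerms (hf : SupportFlow w c h) (n : ℕ) : SmoothFamily (mixedTerms h n) :=
  ContDiffOn.sum fun j _ => ((SmoothFamily.const (n.choose j : ℝ)).mul
    (hf.smooth_curv.iteratedDeriv j)).mul (hf.smooth_radius.iteratedDeriv (n - j))

/-- The `n`-th derivative of `k u = 1`, with the two extreme Leibniz terms split off. Multiplied by
`k`, it reads `k^(n) = -k (k u^(n) + S)`. -/
theorem leibniz_curv_radius (hf : SupportFlow w c h) (ht : 0 < t) {n : ℕ} (hn : 1 ≤ n) (θ : ℝ) :
    curv h t θ * iteratedDeriv n (radius h t) θ + iteratedDeriv n (curv h t) θ * radius h t θ +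
      mixedTerms h n t θ = 0 := by
  have hk := ((hf.smooth_curv.slice ht).of_le (m := n) (mod_cast le_top)).contDiffAt (x := θ)
  have hu := ((hf.smooth_radius.slice ht).of_le (m := n) (mod_cast le_top)).contDiffAt (x := θ)
  have h1 : curv h t * radius h t = fun _ => 1 := funext fun x => by
    rw [Pi.mul_apply, mul_comm, hf.radius_mul_curv ht]
  have h2 := iteratedDeriv_mul hk hu
  rw [h1, iteratedDeriv_const, if_neg (by omega), Finset.sum_range_succ, Finset.range_eq_Ico,
    Finset.sum_eq_sum_Ico_succ_bot (by omega)] at h2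
  simp only [Nat.choose_zero_right, Nat.choose_self, Nat.cast_one, one_mul, iteratedDeriv_zero,
    Nat.sub_zero, Nat.sub_self, zero_add] at h2
  rw [mixedTerms]
  linarith

theorem curv_bounds (hf : SupportFlow w c h) (hw : 1 ≤ w) (hc : 0 < c) :
    ∀ᶠ t in atTop, ∀ θ, √c / 2 ≤ curv h t θ ∧ curv h t θ ≤ 2 * √c := by
  obtain ⟨B, hB, hBk⟩ := hf.curv_convergence hw hc
  have hsc : 0 < √c := sqrt_pos.2 hc
  filter_upwards [hBk, hB.eventually (ge_mem_nhds (half_pos hsc))] with t h1 h2 θ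
  have := abs_le.1 (h1 θ).1
  constructor <;> linarith

theorem radius_bound (hf : SupportFlow w c h) (hw : 1 ≤ w) (hc : 0 < c) :
    ∀ᶠ t in atTop, ∀ θ, radius h t θ ^ 2 ≤ 4 / c := by
  filter_upwards [hf.curv_bounds hw hc, eventually_gt_atTop 0] with t h1 ht θ
  have hsc : 0 < √c := sqrt_pos.2 hc
  have hu := hf.radius_pos t ht θ
  have h2 := mul_le_mul_of_nonneg_left (h1 θ).1 hu.le
  rw [hf.radius_mul_curv ht] at h2
  rw [le_div_iff₀ hc]
  have h3 := pow_le_pow_left₀ (by positivity) h2 2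
  have h4 : √c ^ 2 = c := sq_sqrt hc.le
  calc radius h t θ ^ 2 * c = 4 * (radius h t θ * (√c / 2)) ^ 2 := by
        linear_combination (-radius h t θ ^ 2) * h4
    _ ≤ 4 * 1 ^ 2 := by gcongr
    _ = 4 := by norm_num

/-- The evolution equation gives `k'' = (h_t + c (h - r)) + (√c - k)`: the first bracket decays in
`L²` and the second is uniformly small. This bound starts the bootstrap. -/
theorem energy_curv_two_isBigO_one (hf : SupportFlow w c h) (hw : 1 ≤ w) (hc : 0 < c) :
    energy (2 * w * π) (curv h) 2 =O[atTop] (1 : ℝ → ℝ) := by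
  have hP := winding_period_pos hw
  obtain ⟨C₁, hC₁⟩ := hf.integral_sq_sub_decay hc
  obtain ⟨C₂, hC₂⟩ := hf.integral_sq_speed_decay
  have hexp : (fun t => exp (-2 * c * t)) =O[atTop] (1 : ℝ → ℝ) := by
    refine isBigO_of_le_mul 1 (fun t => (exp_pos _).le) ?_
    filter_upwards [eventually_gt_atTop 0] with t ht
    simp only [Pi.one_apply, mul_one]
    exact exp_le_one_iff.2 (by nlinarith)
  have hO : ∀ (C : ℝ) (X : ℝ → ℝ → ℝ), (∀ᶠ t in atTop,
      ∫ θ in (0 : ℝ)..(2 * w * π), X t θ ^ 2 ≤ C * exp (-2 * c * t)) →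
      (fun t => ∫ θ in (0 : ℝ)..(2 * w * π), X t θ ^ 2) =O[atTop] (1 : ℝ → ℝ) :=
    fun C X hX => (isBigO_of_le_mul C
      (fun t => intervalIntegral.integral_nonneg hP.le fun _ _ => sq_nonneg _) hX).trans hexp
  obtain ⟨B, hB, hBk⟩ := hf.curv_convergence hw hc
  have hdiff : (fun t => ∫ θ in (0 : ℝ)..(2 * w * π), (√c - curv h t θ) ^ 2)
      =O[atTop] (1 : ℝ → ℝ) := by
    refine isBigO_of_le_mul (2 * w * π)
      (fun t => intervalIntegral.integral_nonneg hP.le fun _ _ => sq_nonneg _) ?_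
    filter_upwards [hBk, hB.eventually (ge_mem_nhds zero_lt_one), eventually_gt_atTop 0]
      with t h1 h2 ht
    have hkc := (hf.smooth_curv.slice ht).continuous
    have := intervalIntegral.integral_mono_on hP.le
      ((by fun_prop : Continuous fun θ => (√c - curv h t θ) ^ 2).intervalIntegrable
        (μ := MeasureTheory.volume) _ _)
      (intervalIntegrable_const (c := (1 : ℝ))) fun θ _ => by
        rw [← sq_abs, abs_sub_comm]
        exact pow_le_one₀ (abs_nonneg _) ((h1 θ).1.trans h2)
    simpa using this
  have hsub := hf.smooth.sub (SmoothFamily.const (√c)⁻¹)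
  have hsubk := (SmoothFamily.const (√c)).sub hf.smooth_curv
  have hsum := integral_sq_isBigO_of_le_add hP (2 + 2 * c ^ 2)
    (hf.smooth_speed.add ((SmoothFamily.const c).mul hsub)) hf.smooth_speed hsub
    (Eventually.of_forall fun t θ => by
      nlinarith [sq_nonneg (speed c h t θ - c * (h t θ - (√c)⁻¹)), sq_nonneg (speed c h t θ),
        sq_nonneg (h t θ - (√c)⁻¹), sq_nonneg (c * (speed c h t θ))])
    (hO _ _ hC₂) (hO _ (fun t θ => h t θ - (√c)⁻¹) hC₁)
  refine integral_sq_isBigO_of_le_add hP 2 (hf.smooth_curv.iteratedDeriv 2)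
    (hf.smooth_speed.add ((SmoothFamily.const c).mul hsub)) hsubk
    (Eventually.of_forall fun t θ => ?_) hsum hdiff
  have hcr : c * (√c)⁻¹ = √c := by rw [← div_eq_mul_inv, div_sqrt]
  have e1 : iteratedDeriv 2 (curv h t) θ =
      (speed c h t θ + c * (h t θ - (√c)⁻¹)) + (√c - curv h t θ) := by
    simp only [speed]
    linear_combination hcr
  rw [e1]
  nlinarith [sq_nonneg ((speed c h t θ + c * (h t θ - (√c)⁻¹)) - (√c - curv h t θ))]

theorem energy_curv_isBigO (hf : SupportFlow w c h) (hw : 1 ≤ w) (hc : 0 < c) {n : ℕ}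
    (hn : 1 ≤ n)
    (hS : (fun t => ∫ θ in (0 : ℝ)..(2 * w * π), mixedTerms h n t θ ^ 2)
      =O[atTop] energy (2 * w * π) (radius h) n) :
    energy (2 * w * π) (curv h) n =O[atTop] energy (2 * w * π) (radius h) n := by
  have hP := winding_period_pos hw
  refine integral_sq_isBigO_of_le_add hP (2 * (4 * c) * (4 * c + 1))
    (hf.smooth_curv.iteratedDeriv n) (hf.smooth_radius.iteratedDeriv n)
    (hf.smooth_mixedTerms n) ?_ (isBigO_refl _ _) hS
  filter_upwards [hf.curv_bounds hw hc, eventually_gt_atTop 0] with t h1 ht θ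
  have hk := hf.curv_pos ht θ
  have h2 : curv h t θ ^ 2 ≤ 4 * c := by
    have := pow_le_pow_left₀ hk.le (h1 θ).2 2
    rwa [mul_pow, sq_sqrt hc.le, show (2 : ℝ) ^ 2 = 4 by norm_num] at this
  have h3 := hf.leibniz_curv_radius ht hn θ
  have h4 := hf.radius_mul_curv ht θ
  set k := curv h t θ
  set x := iteratedDeriv n (radius h t) θ
  set S := mixedTerms h n t θ
  have e1 : iteratedDeriv n (curv h t) θ = -(k * (k * x + S)) := by
    linear_combination k * h3 - iteratedDeriv n (curv h t) θ * h4
  have h5 : (k * x + S) ^ 2 ≤ 2 * (k ^ 2 * x ^ 2 + S ^ 2) := by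
    nlinarith [sq_nonneg (k * x - S)]
  have h6 : k ^ 2 * x ^ 2 ≤ 4 * c * x ^ 2 := mul_le_mul_of_nonneg_right h2 (sq_nonneg x)
  calc iteratedDeriv n (curv h t) θ ^ 2 = k ^ 2 * (k * x + S) ^ 2 := by rw [e1]; ring
    _ ≤ (4 * c) * (2 * (k ^ 2 * x ^ 2 + S ^ 2)) := by gcongr
    _ ≤ (4 * c) * (2 * ((4 * c + 1) * (x ^ 2 + S ^ 2))) := by
        gcongr
        nlinarith [mul_nonneg hc.le (sq_nonneg S), sq_nonneg x]
    _ = _ := by ring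

theorem mixedTerms_one (h : ℝ → ℝ → ℝ) (t θ : ℝ) : mixedTerms h 1 t θ = 0 := by
  simp [mixedTerms]

/-- Transfers the curvature bound to the radius through `u' = -u² k'` and `u'' = -u (u k'' + 2 k'
u')`; the product `k' u'` is controlled by the sup norm of `k'`. -/
theorem energy_radius_two_isBigO_one (hf : SupportFlow w c h) (hw : 1 ≤ w) (hc : 0 < c) :
    energy (2 * w * π) (radius h) 2 =O[atTop] (1 : ℝ → ℝ) := by
  have hP := winding_period_pos hw
  have hkP : ∀ t, 0 < t → Function.Periodic (curv h t) (2 * w * π) := fun t ht =>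
    hf.periodic_curv ht
  have hK2 := hf.energy_curv_two_isBigO_one hw hc
  have hK1 := (energy_isBigO_succ hP hf.smooth_curv hkP le_rfl).trans hK2
  have hU1 : energy (2 * w * π) (radius h) 1 =O[atTop] (1 : ℝ → ℝ) := by
    refine integral_sq_isBigO_of_le_add hP (4 / c * (4 / c))
      (hf.smooth_radius.iteratedDeriv 1) (hf.smooth_curv.iteratedDeriv 1)
      (hf.smooth_curv.iteratedDeriv 1) ?_ hK1 hK1
    filter_upwards [hf.radius_bound hw hc, eventually_gt_atTop 0] with t h1 ht θ
    have h3 := hf.leibniz_curv_radius ht le_rfl θ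
    rw [mixedTerms_one, add_zero] at h3
    have h4 := hf.radius_mul_curv ht θ
    set u := radius h t θ
    set y := iteratedDeriv 1 (curv h t) θ
    have e1 : iteratedDeriv 1 (radius h t) θ = -(u * (u * y)) := by
      linear_combination u * h3 - iteratedDeriv 1 (radius h t) θ * h4
    have h5 := h1 θ
    calc iteratedDeriv 1 (radius h t) θ ^ 2 = u ^ 2 * u ^ 2 * y ^ 2 := by rw [e1]; ring
      _ ≤ 4 / c * (4 / c) * y ^ 2 := by gcongr
      _ ≤ _ := by gcongr; linarith [sq_nonneg y]
  have hprod := integral_sq_mul_isBigO hP hf.smooth_curv hf.smooth_radius hkP le_rfl 1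
  have hprod' := hprod.trans ((hK2.mul hU1).congr_right fun _ => mul_one _)
  refine integral_sq_isBigO_of_le_add hP (4 / c * (8 + 2 * (4 / c)))
    (hf.smooth_radius.iteratedDeriv 2)
    ((hf.smooth_curv.iteratedDeriv 1).mul (hf.smooth_radius.iteratedDeriv 1))
    (hf.smooth_curv.iteratedDeriv 2) ?_ hprod' hK2
  filter_upwards [hf.radius_bound hw hc, eventually_gt_atTop 0] with t h1 ht θ
  have h3 := hf.leibniz_curv_radius ht one_le_two θ
  have h4 := hf.radius_mul_curv ht θ
  have h5 := h1 θ
  simp only [mixedTerms, show Finset.Ico 1 2 = {1} from rfl, Finset.sum_singleton,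
    Nat.choose_one_right, Nat.cast_ofNat] at h3
  set u := radius h t θ
  set y := iteratedDeriv 2 (curv h t) θ
  set p := iteratedDeriv 1 (curv h t) θ
  set q := iteratedDeriv 1 (radius h t) θ
  have e1 : iteratedDeriv 2 (radius h t) θ = -(u * (u * y + 2 * (p * q))) := by
    linear_combination u * h3 - iteratedDeriv 2 (radius h t) θ * h4
  have h6 : (u * y + 2 * (p * q)) ^ 2 ≤ 2 * (u ^ 2 * y ^ 2) + 8 * (p * q) ^ 2 := by
    nlinarith [sq_nonneg (u * y - 2 * (p * q))]
  have h7 : u ^ 2 * y ^ 2 ≤ 4 / c * y ^ 2 := mul_le_mul_of_nonneg_right h5 (sq_nonneg y)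
  have h8 : 0 ≤ 4 / c := by positivity
  calc iteratedDeriv 2 (radius h t) θ ^ 2 = u ^ 2 * (u * y + 2 * (p * q)) ^ 2 := by rw [e1]; ring
    _ ≤ 4 / c * (2 * (u ^ 2 * y ^ 2) + 8 * (p * q) ^ 2) := by gcongr
    _ ≤ 4 / c * ((8 + 2 * (4 / c)) * ((p * q) ^ 2 + y ^ 2)) := by
        gcongr
        nlinarith [mul_nonneg h8 (sq_nonneg (p * q)), sq_nonneg y]
    _ = _ := by ring

/-- The product estimate needs bounded energies up to order `max 2 (n / 2)`. Orders `1` and `2` are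
the base bounds; if `3 ≤ i ≤ n / 2` then `i + 2 < n`, so `hU` applies. -/
theorem mixedTerms_isBigO (hf : SupportFlow w c h) (hw : 1 ≤ w) (hc : 0 < c) {n : ℕ}
    (hKU : ∀ i, 1 ≤ i → i < n →
      energy (2 * w * π) (curv h) i =O[atTop] energy (2 * w * π) (radius h) i)
    (hU : ∀ i, 1 ≤ i → i + 2 < n → energy (2 * w * π) (radius h) i =O[atTop] (1 : ℝ → ℝ)) :
    (fun t => ∫ θ in (0 : ℝ)..(2 * w * π), mixedTerms h n t θ ^ 2)
      =O[atTop] energy (2 * w * π) (radius h) (n - 1) := by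
  have hP := winding_period_pos hw
  have hkP : ∀ t, 0 < t → Function.Periodic (curv h t) (2 * w * π) := fun t ht =>
    hf.periodic_curv ht
  have huP : ∀ t, 0 < t → Function.Periodic (radius h t) (2 * w * π) := fun t ht =>
    hf.periodic_radius ht
  have hU' : ∀ i, 1 ≤ i → i ≤ max 2 (n / 2) →
      energy (2 * w * π) (radius h) i =O[atTop] (1 : ℝ → ℝ) := by
    intro i hi hin
    rcases le_or_gt i 2 with h2 | h2
    · exact (energy_isBigO_of_le hP hf.smooth_radius huP hi h2).trans
        (hf.energy_radius_two_isBigO_one hw hc)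
    · exact hU i hi (by omega)
  have hK' : ∀ i, 1 ≤ i → i ≤ max 2 (n / 2) →
      energy (2 * w * π) (curv h) i =O[atTop] (1 : ℝ → ℝ) := by
    intro i hi hin
    rcases le_or_gt i 2 with h2 | h2
    · exact (energy_isBigO_of_le hP hf.smooth_curv hkP hi h2).trans
        (hf.energy_curv_two_isBigO_one hw hc)
    · exact (hKU i hi (by omega)).trans (hU' i hi hin)
  have hsum : (fun t => ∑ j ∈ Finset.Ico 1 n, ∫ θ in (0 : ℝ)..(2 * w * π),
      (iteratedDeriv j (curv h t) θ * iteratedDeriv (n - j) (radius h t) θ) ^ 2)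
      =O[atTop] energy (2 * w * π) (radius h) (n - 1) := by
    refine IsBigO.fun_sum fun j hj => ?_
    rw [Finset.mem_Ico] at hj
    exact integral_sq_mul_isBigO_energy hP hf.smooth_curv hf.smooth_radius hkP huP hKU hK' hU'
      hj.1 hj.2
  -- Cauchy–Schwarz over the sum gives the cardinality, and each binomial coefficient is at most `2
  -- ^ n`.
  refine (isBigO_of_le_mul ((Finset.Ico 1 n).card * (2 ^ n : ℝ) ^ 2)
    (fun t => intervalIntegral.integral_nonneg hP.le fun _ _ => sq_nonneg _) ?_).trans hsum
  filter_upwards [eventually_gt_atTop 0] with t ht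
  have hkc : ∀ j, Continuous (iteratedDeriv j (curv h t)) := fun j =>
    (contDiff_iteratedDeriv (hf.smooth_curv.slice ht) j).continuous
  have huc : ∀ j, Continuous (iteratedDeriv j (radius h t)) := fun j =>
    (contDiff_iteratedDeriv (hf.smooth_radius.slice ht) j).continuous
  have hprod : ∀ j, Continuous fun θ =>
      (iteratedDeriv j (curv h t) θ * iteratedDeriv (n - j) (radius h t) θ) ^ 2 := fun j =>
    ((hkc j).mul (huc (n - j))).pow 2
  have hmc := ((hf.smooth_mixedTerms n).slice ht).continuous
  rw [← intervalIntegral.integral_finsetSum fun j _ => (hprod j).intervalIntegrable _ _,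
    ← intervalIntegral.integral_const_mul]
  refine intervalIntegral.integral_mono_on hP.le
    ((by fun_prop : Continuous _).intervalIntegrable _ _)
    ((continuous_const.mul (continuous_finsetSum _ fun j _ => hprod j)).intervalIntegrable _ _)
    fun θ _ => ?_
  refine sq_sum_le_card_mul_sum_sq.trans ?_
  rw [mul_assoc]
  refine mul_le_mul_of_nonneg_left ?_ (Nat.cast_nonneg _)
  rw [Finset.mul_sum]
  refine Finset.sum_le_sum fun j _ => ?_
  rw [mul_assoc, mul_pow]
  have : (n.choose j : ℝ) ≤ 2 ^ n := by exact_mod_cast Nat.choose_le_two_pow n j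
  gcongr

/-! ### Dissipation and the Lyapunov induction -/

theorem iteratedDeriv_radius (hf : SupportFlow w c h) (ht : 0 < t) (n : ℕ) (θ : ℝ) :
    iteratedDeriv n (radius h t) θ =
      iteratedDeriv 2 (iteratedDeriv n (h t)) θ + iteratedDeriv n (h t) θ := by
  have hh := hf.smooth.slice ht
  rw [iteratedDeriv_two_iteratedDeriv]
  exact iteratedDeriv_fun_add
    ((contDiff_iteratedDeriv hh 2).of_le (m := n) (mod_cast le_top)).contDiffAt
    (hh.of_le (m := n) (mod_cast le_top)).contDiffAt

theorem iteratedDeriv_speed (hf : SupportFlow w c h) (ht : 0 < t) (n : ℕ) (θ : ℝ) :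
    iteratedDeriv n (speed c h t) θ =
      iteratedDeriv 2 (iteratedDeriv n (curv h t)) θ + iteratedDeriv n (curv h t) θ -
        c * iteratedDeriv n (h t) θ := by
  have hh := (hf.smooth.slice ht).of_le (m := n) (mod_cast le_top)
  have hk := (hf.smooth_curv.slice ht).of_le (m := n) (mod_cast le_top)
  have hk2 := (contDiff_iteratedDeriv (hf.smooth_curv.slice ht) 2).of_le (m := n)
    (mod_cast le_top)
  rw [iteratedDeriv_two_iteratedDeriv]
  refine (iteratedDeriv_fun_sub (hk2.add hk).contDiffAt
    (contDiff_const.mul hh).contDiffAt).trans ?_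
  congr 1
  · exact iteratedDeriv_fun_add hk2.contDiffAt hk.contDiffAt
  · exact iteratedDeriv_const_mul_field _ _

theorem hasDerivAt_energy (hf : SupportFlow w c h) (ht : 0 < t) (n : ℕ) :
    HasDerivAt (energy (2 * w * π) h n) (∫ θ in (0 : ℝ)..(2 * w * π),
      2 * (iteratedDeriv n (h t) θ * iteratedDeriv n (speed c h t) θ)) t :=
  (hf.smooth.iteratedDeriv n).hasDerivAt_integral_sq
    (hf.smooth.hasDerivAt_iteratedDeriv hf.evolution n) _ _ ht

/-- The dissipation inequality for the `n`-th derivative of the support function. -/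
theorem energy_deriv_le (hf : SupportFlow w c h) (hw : 1 ≤ w) (hc : 0 < c) {n : ℕ} (hn : 1 ≤ n) :
    ∀ᶠ t in atTop, ∫ θ in (0 : ℝ)..(2 * w * π),
      2 * (iteratedDeriv n (h t) θ * iteratedDeriv n (speed c h t) θ) ≤
        -2 * c * energy (2 * w * π) h n t - c / 4 * energy (2 * w * π) (radius h) n t +
          ∫ θ in (0 : ℝ)..(2 * w * π), mixedTerms h n t θ ^ 2 := by
  have hP := winding_period_pos hw
  filter_upwards [hf.curv_bounds hw hc, eventually_gt_atTop 0] with t h1 ht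
  have hh := contDiff_iteratedDeriv (hf.smooth.slice ht) n
  have hk := contDiff_iteratedDeriv (hf.smooth_curv.slice ht) n
  have hu := contDiff_iteratedDeriv (hf.smooth_radius.slice ht) n
  have hk2 := contDiff_iteratedDeriv hk 2
  have hhc := hh.continuous
  have hkc := hk.continuous
  have huc := hu.continuous
  have hk2c := hk2.continuous
  have hmc := ((hf.smooth_mixedTerms n).slice ht).continuous
  have hsa := integral_mul_iteratedDeriv_two_add hh hk (periodic_iteratedDeriv (hf.periodic t ht) n)
    (periodic_iteratedDeriv (hf.periodic_curv ht) n)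
  simp only [← hf.iteratedDeriv_radius ht] at hsa
  have hsplit : ∀ θ, 2 * (iteratedDeriv n (h t) θ * iteratedDeriv n (speed c h t) θ) =
      2 * (iteratedDeriv n (h t) θ * (iteratedDeriv 2 (iteratedDeriv n (curv h t)) θ +
        iteratedDeriv n (curv h t) θ)) + (-2 * c) * iteratedDeriv n (h t) θ ^ 2 := fun θ => by
    rw [hf.iteratedDeriv_speed ht]
    ring
  simp only [hsplit]
  rw [intervalIntegral.integral_add ((by fun_prop : Continuous _).intervalIntegrable _ _)
    ((by fun_prop : Continuous _).intervalIntegrable _ _), intervalIntegral.integral_const_mul,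
    intervalIntegral.integral_const_mul, hsa, ← intervalIntegral.integral_const_mul 2]
  have hmain : ∫ θ in (0 : ℝ)..(2 * w * π),
      2 * (iteratedDeriv n (radius h t) θ * iteratedDeriv n (curv h t) θ) ≤
      ∫ θ in (0 : ℝ)..(2 * w * π),
        (-(c / 4) * iteratedDeriv n (radius h t) θ ^ 2 + mixedTerms h n t θ ^ 2) := by
    refine intervalIntegral.integral_mono_on hP.le
      ((by fun_prop : Continuous _).intervalIntegrable _ _)
      ((by fun_prop : Continuous _).intervalIntegrable _ _) fun θ _ => ?_
    have hsc : 0 < √c := sqrt_pos.2 hc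
    have h2 : c / 4 ≤ curv h t θ ^ 2 := by
      have := pow_le_pow_left₀ (by positivity) (h1 θ).1 2
      rwa [div_pow, sq_sqrt hc.le, show (2 : ℝ) ^ 2 = 4 by norm_num] at this
    have h3 := hf.leibniz_curv_radius ht hn θ
    have h4 := hf.radius_mul_curv ht θ
    set k := curv h t θ
    set x := iteratedDeriv n (radius h t) θ
    set S := mixedTerms h n t θ
    have e1 : iteratedDeriv n (curv h t) θ = -(k * (k * x + S)) := by
      linear_combination k * h3 - iteratedDeriv n (curv h t) θ * h4
    rw [e1]
    -- Here `-2kx(kx + S) ≤ -k²x² + S²` is `(kx + S)² ≥ 0`, and `k² ≥ c/4`.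
    nlinarith [sq_nonneg (k * x + S), mul_le_mul_of_nonneg_right h2 (sq_nonneg x)]
  rw [intervalIntegral.integral_add ((by fun_prop : Continuous _).intervalIntegrable _ _)
    ((by fun_prop : Continuous _).intervalIntegrable _ _),
    intervalIntegral.integral_const_mul (-(c / 4))] at hmain
  simp only [energy]
  linarith

/-- Bounds on `h` pass to `u` at a loss of two derivatives; hence the condition `i + 2 < n` in
`mixedTerms_isBigO`. -/
theorem energy_radius_le (hf : SupportFlow w c h) (hw : 1 ≤ w) (n : ℕ) :
    ∀ᶠ t in atTop, energy (2 * w * π) (radius h) n t ≤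
      2 * (energy (2 * w * π) h (n + 2) t + energy (2 * w * π) h n t) := by
  have hP := winding_period_pos hw
  filter_upwards [eventually_gt_atTop 0] with t ht
  have hhc := (contDiff_iteratedDeriv (hf.smooth.slice ht) n).continuous
  have hhc2 := (contDiff_iteratedDeriv (hf.smooth.slice ht) (n + 2)).continuous
  have huc := (contDiff_iteratedDeriv (hf.smooth_radius.slice ht) n).continuous
  simp only [energy]
  rw [← intervalIntegral.integral_add ((by fun_prop : Continuous _).intervalIntegrable _ _)
    ((by fun_prop : Continuous _).intervalIntegrable _ _), ← intervalIntegral.integral_const_mul]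
  refine intervalIntegral.integral_mono_on hP.le
    ((by fun_prop : Continuous _).intervalIntegrable _ _)
    ((by fun_prop : Continuous _).intervalIntegrable _ _) fun θ _ => ?_
  have e1 : iteratedDeriv 2 (iteratedDeriv n (h t)) = iteratedDeriv (n + 2) (h t) := by
    simp only [iteratedDeriv_eq_iterate, ← Function.iterate_add_apply, add_comm]
  rw [hf.iteratedDeriv_radius ht, e1]
  nlinarith [sq_nonneg (iteratedDeriv (n + 2) (h t) θ - iteratedDeriv n (h t) θ)]

/-- There is a functional above the `n`-th energy of the support function that decays at the rate
`2c`, with the `n`-th energy of the radius as an additional dissipation. -/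
def HasLyapunov (w : ℕ) (c : ℝ) (h : ℝ → ℝ → ℝ) (n : ℕ) : Prop :=
  ∃ Z Z' : ℝ → ℝ, (∀ᶠ t in atTop, HasDerivAt Z (Z' t) t) ∧
    (∀ᶠ t in atTop, Z' t ≤ -2 * c * Z t - c / 4 * energy (2 * w * π) (radius h) n t) ∧
    ∀ᶠ t in atTop, energy (2 * w * π) h n t ≤ Z t

theorem energy_decay_of_hasLyapunov (hw : 1 ≤ w) (hc : 0 < c) {n : ℕ} (hZ : HasLyapunov w c h n) :
    ∃ C, ∀ᶠ t in atTop, energy (2 * w * π) h n t ≤ C * exp (-2 * c * t) := by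
  obtain ⟨Z, Z', hd, hle, hE⟩ := hZ
  obtain ⟨C, hC⟩ := exists_exp_decay hd (a := -2 * c) <| by
    filter_upwards [hle] with t ht
    have := energy_nonneg (winding_period_pos hw) (radius h) n t
    nlinarith
  exact ⟨C, by filter_upwards [hC, hE] with t h1 h2 using h2.trans h1⟩

theorem energy_isBigO_one_of_hasLyapunov (hw : 1 ≤ w) (hc : 0 < c) {n : ℕ}
    (hZ : HasLyapunov w c h n) : energy (2 * w * π) h n =O[atTop] (1 : ℝ → ℝ) := by
  obtain ⟨C, hC⟩ := energy_decay_of_hasLyapunov hw hc hZ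
  refine isBigO_of_le_mul |C| (energy_nonneg (winding_period_pos hw) h n) ?_
  filter_upwards [hC, eventually_gt_atTop 0] with t h1 ht
  have h2 : exp (-2 * c * t) ≤ 1 := exp_le_one_iff.2 (by nlinarith)
  exact h1.trans (mul_le_mul (le_abs_self C) h2 (exp_pos _).le (abs_nonneg _))

/-- Both claims go through one strong induction: the mixed terms of order `n` need the comparison of
`k` with `u` below `n` and bounded low-order energies of `u`, which the lower functionals supply. -/
theorem hasLyapunov_and_energy_curv_isBigO (hf : SupportFlow w c h) (hw : 1 ≤ w) (hc : 0 < c)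
    (n : ℕ) : 1 ≤ n → HasLyapunov w c h n ∧
      energy (2 * w * π) (curv h) n =O[atTop] energy (2 * w * π) (radius h) n := by
  have hP := winding_period_pos hw
  induction n using Nat.strong_induction_on with
  | _ n ih =>
  intro hn
  have hS := hf.mixedTerms_isBigO hw hc (fun i hi hin => (ih i hin hi).2) fun i hi hin => by
    have h1 := energy_isBigO_one_of_hasLyapunov hw hc (ih i (by omega) hi).1
    have h2 := energy_isBigO_one_of_hasLyapunov hw hc (ih (i + 2) hin (by omega)).1
    exact (isBigO_of_le_mul 2 (energy_nonneg hP _ _) (hf.energy_radius_le hw i)).trans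
      (h2.add h1)
  have hev : ∀ᶠ t in atTop, HasDerivAt (energy (2 * w * π) h n) _ t :=
    (eventually_gt_atTop 0).mono fun t ht => hf.hasDerivAt_energy ht n
  have hd := hf.energy_deriv_le hw hc hn
  rcases hn.eq_or_lt with rfl | hn1
  -- At order one there are no mixed terms, so the energy itself is the functional.
  · have hS0 : ∀ t, ∫ θ in (0 : ℝ)..(2 * w * π), mixedTerms h 1 t θ ^ 2 = 0 := fun t => by
      simp [mixedTerms_one]
    refine ⟨⟨_, _, hev, ?_, Eventually.of_forall fun _ => le_rfl⟩,
      hf.energy_curv_isBigO hw hc le_rfl ?_⟩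
    · filter_upwards [hd] with t ht
      rwa [hS0, add_zero] at ht
    · simp only [hS0]
      exact isBigO_zero _ _
  · obtain ⟨m, rfl⟩ : ∃ m, n = m + 1 := ⟨n - 1, by omega⟩
    have hm : 1 ≤ m := by omega
    refine ⟨?_, hf.energy_curv_isBigO hw hc hn (hS.trans ?_)⟩
    · obtain ⟨Z, Z', hZd, hZle, hZE⟩ := (ih m (by omega) hm).1
      obtain ⟨C, hC0, hC⟩ := exists_le_mul_of_isBigO (energy_nonneg hP (radius h) m) hS
      -- The weight `4C/c` makes the dissipation `c/4` of `Z` at level `m` cancel exactly the error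
      -- `C ∫ (u^(m))²`.
      refine ⟨fun t => energy (2 * w * π) h (m + 1) t + 4 * C / c * Z t, _,
        (hev.and hZd).mono fun t ht => ht.1.add (ht.2.const_mul _), ?_, ?_⟩
      · filter_upwards [hd, hZle, hC] with t h1 h2 h3
        have h4 := mul_le_mul_of_nonneg_left h2 (by positivity : 0 ≤ 4 * C / c)
        have e1 : 4 * C / c * (-2 * c * Z t - c / 4 * energy (2 * w * π) (radius h) m t) =
            -2 * c * (4 * C / c * Z t) - C * energy (2 * w * π) (radius h) m t := by
          field_simp
        rw [e1] at h4
        linarith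
      · filter_upwards [hZE] with t h1
        have h2 := (energy_nonneg hP h m t).trans h1
        have h3 : 0 ≤ 4 * C / c * Z t := by positivity
        linarith
    · exact energy_isBigO_succ hP hf.smooth_radius (fun t ht => hf.periodic_radius ht) hm

/-! ### Smooth convergence -/

/-- All derivatives of the support function decay exponentially in `L²`. -/
theorem energy_decay (hf : SupportFlow w c h) (hw : 1 ≤ w) (hc : 0 < c) {n : ℕ} (hn : 1 ≤ n) :
    ∃ C, ∀ᶠ t in atTop, energy (2 * w * π) h n t ≤ C * exp (-2 * c * t) :=
  energy_decay_of_hasLyapunov hw hc (hf.hasLyapunov_and_energy_curv_isBigO hw hc n hn).1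

theorem tendsto_energy (hf : SupportFlow w c h) (hw : 1 ≤ w) (hc : 0 < c) {n : ℕ} (hn : 1 ≤ n) :
    Tendsto (energy (2 * w * π) h n) atTop (𝓝 0) := by
  obtain ⟨C, hC⟩ := hf.energy_decay hw hc hn
  have hexp : Tendsto (fun t => C * exp (-2 * c * t)) atTop (𝓝 0) := by
    have := (tendsto_exp_atBot.comp
      (tendsto_id.const_mul_atTop_of_neg (by linarith : -2 * c < 0))).const_mul C
    simpa using this
  exact tendsto_of_tendsto_of_tendsto_of_le_of_le' tendsto_const_nhds hexp
    (Eventually.of_forall (energy_nonneg (winding_period_pos hw) h n)) hC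

theorem tendstoUniformly_of_energy {P : ℝ} (hP : 0 < P) {F : ℝ → ℝ → ℝ} (hF : SmoothFamily F)
    (hFP : ∀ t, 0 < t → Function.Periodic (F t) P) (n : ℕ)
    (h0 : Tendsto (energy P F n) atTop (𝓝 0)) (h1 : Tendsto (energy P F (n + 1)) atTop (𝓝 0)) :
    TendstoUniformly (fun t θ => iteratedDeriv n (F t) θ) (fun _ => 0) atTop := by
  rw [Metric.tendstoUniformly_iff]
  intro ε hε
  have hlim := (h0.add h1).const_mul (P⁻¹ + 1)
  rw [add_zero, mul_zero] at hlim
  filter_upwards [hlim.eventually (gt_mem_nhds (pow_pos hε 2)), eventually_gt_atTop 0]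
    with t h2 ht θ
  have h3 := sq_le_integral_sq_add hP (contDiff_iteratedDeriv (hF.slice ht) n)
    (periodic_iteratedDeriv (hFP t ht) n) θ
  rw [← iteratedDeriv_succ] at h3
  rw [dist_zero_left, norm_eq_abs]
  exact abs_lt_of_sq_lt_sq (h3.trans_lt h2) hε.le

/-- Smooth convergence to the stationary circle. -/
theorem tendstoUniformly_iteratedDeriv (hf : SupportFlow w c h) (hw : 1 ≤ w) (hc : 0 < c)
    (n : ℕ) : TendstoUniformly (fun t θ => iteratedDeriv n (h t) θ)
      (iteratedDeriv n fun _ : ℝ => (√c)⁻¹) atTop := by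
  have hP := winding_period_pos hw
  rcases Nat.eq_zero_or_pos n with rfl | hn
  · obtain ⟨C, hC⟩ := hf.integral_sq_sub_decay hc
    have hexp : Tendsto (fun t => C * exp (-2 * c * t)) atTop (𝓝 0) := by
      have := (tendsto_exp_atBot.comp
        (tendsto_id.const_mul_atTop_of_neg (by linarith : -2 * c < 0))).const_mul C
      simpa using this
    -- At order zero `h` itself does not decay, so the Sobolev argument is applied to `h - r`.
    have h0 : Tendsto (energy (2 * w * π) (fun t θ => h t θ - (√c)⁻¹) 0) atTop (𝓝 0) := by
      refine tendsto_of_tendsto_of_tendsto_of_le_of_le' tendsto_const_nhds hexp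
        (Eventually.of_forall (energy_nonneg hP _ 0)) ?_
      simpa only [energy, iteratedDeriv_zero] using hC
    have h1 : Tendsto (energy (2 * w * π) (fun t θ => h t θ - (√c)⁻¹) 1) atTop (𝓝 0) := by
      refine (hf.tendsto_energy hw hc le_rfl).congr fun t => ?_
      simp only [energy, iteratedDeriv_one, deriv_sub_const_fun]
    have := tendstoUniformly_of_energy hP (hf.smooth.sub (SmoothFamily.const _))
      (fun t ht θ => congrArg (· - (√c)⁻¹) (hf.periodic t ht θ)) 0 h0 h1
    rw [Metric.tendstoUniformly_iff] at this ⊢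
    simpa [Real.dist_eq, abs_sub_comm] using this
  · have := tendstoUniformly_of_energy hP hf.smooth hf.periodic n (hf.tendsto_energy hw hc hn)
      (hf.tendsto_energy hw hc (by omega))
    convert this using 1
    ext θ
    rw [iteratedDeriv_const, if_neg (by omega)]

/-- The integrand is `(k'/k)²`, where `k' → 0` uniformly and `k ≥ √c / 2` eventually. -/
theorem tendsto_integral_sq_deriv_log_curv (hf : SupportFlow w c h) (hw : 1 ≤ w) (hc : 0 < c) :
    Tendsto (fun t => ∫ θ in (0 : ℝ)..(2 * w * π), deriv (fun x => log (curv h t x)) θ ^ 2)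
      atTop (𝓝 0) := by
  have hP := winding_period_pos hw
  have hsc : 0 < √c := sqrt_pos.2 hc
  obtain ⟨B, hB, hBk⟩ := hf.curv_convergence hw hc
  have hlim : Tendsto (fun t => 2 * w * π * (B t / (√c / 2)) ^ 2) atTop (𝓝 0) := by
    have := ((hB.div_const (√c / 2)).pow 2).const_mul (2 * w * π)
    simpa using this
  refine tendsto_of_tendsto_of_tendsto_of_le_of_le' tendsto_const_nhds hlim
    (Eventually.of_forall fun t =>
      intervalIntegral.integral_nonneg hP.le fun _ _ => sq_nonneg _) ?_
  filter_upwards [hBk, hf.curv_bounds hw hc, eventually_gt_atTop 0] with t h1 h2 ht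
  have hk := hf.smooth_curv.slice ht
  have hkc := hk.continuous
  have hk'c := (contDiff_deriv hk).continuous
  have hne : ∀ θ, curv h t θ ≠ 0 := fun θ => (hf.curv_pos ht θ).ne'
  have hlog : ∀ θ, deriv (fun x => log (curv h t x)) θ = deriv (curv h t) θ / curv h t θ :=
    fun θ => ((hasDerivAt_of_contDiff hk θ).log (hne θ)).deriv
  simp only [hlog]
  have hcont : Continuous fun θ => (deriv (curv h t) θ / curv h t θ) ^ 2 :=
    (hk'c.div hkc hne).pow 2
  have := intervalIntegral.integral_mono_on hP.le
    (hcont.intervalIntegrable (μ := MeasureTheory.volume) _ _)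
    (intervalIntegrable_const (c := (B t / (√c / 2)) ^ 2)) fun θ _ => by
      rw [← sq_abs, abs_div, abs_of_pos (hf.curv_pos ht θ)]
      have h3 := (h1 θ).2
      have h4 := (h2 θ).1
      have h5 : 0 ≤ B t := (abs_nonneg _).trans h3
      have h6 := hf.curv_pos ht θ
      gcongr
  simpa using this

end SupportFlow

/-! ### From plane curves to support functions -/

theorem inner_plane (x y : Plane) : ⟪x, y⟫_ℝ = x 0 * y 0 + x 1 * y 1 := by
  simp [PiLp.inner_apply, Fin.sum_univ_two, mul_comm]

theorem support_eq (η : ℝ → Plane) (θ : ℝ) :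
    support η θ = η θ 0 * cos θ + η θ 1 * sin θ := by
  rw [support, inner_plane]
  simp [inwardNormal]

theorem support_smul (a : ℝ) (η : ℝ → Plane) (θ : ℝ) :
    support (fun x => a • η x) θ = a * support η θ := by
  simp only [support_eq, PiLp.smul_apply, smul_eq_mul]
  ring

theorem hasDerivAt_coord {f : ℝ → Plane} {f' : Plane} {x : ℝ} (hf : HasDerivAt f f' x)
    (i : Fin 2) : HasDerivAt (fun y => f y i) (f' i) x :=
  (EuclideanSpace.proj (𝕜 := ℝ) i).hasFDerivAt.comp_hasDerivAt x hf

namespace IsLocallyConvexClosed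

variable {w : ℕ} {η : ℝ → Plane}

theorem smul (hη : IsLocallyConvexClosed w η) {a : ℝ} (ha : 0 < a) :
    IsLocallyConvexClosed w fun x => a • η x := by
  have hd : ∀ θ, deriv (fun x => a • η x) θ = a • deriv η θ := fun θ =>
    deriv_fun_const_smul_field a η
  refine ⟨fun x => by simp only [hη.periodic x], fun θ => ?_, fun θ => ?_⟩
  · rw [hd]
    exact smul_ne_zero ha.ne' (hη.regular θ)
  · rw [hd, norm_smul, norm_of_nonneg ha.le, mul_smul, ← hη.angle]

theorem hasDerivAt_coord_zero (hη : IsLocallyConvexClosed w η) (hs : ContDiff ℝ ∞ η) (θ : ℝ) :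
    HasDerivAt (fun x => η x 0) (-(‖deriv η θ‖ * sin θ)) θ := by
  refine (hasDerivAt_coord (hs.differentiable (by simp) θ).hasDerivAt 0).congr_deriv ?_
  simpa [unitTangent] using congrArg (fun v : Plane => v 0) (hη.angle θ)

theorem hasDerivAt_coord_one (hη : IsLocallyConvexClosed w η) (hs : ContDiff ℝ ∞ η) (θ : ℝ) :
    HasDerivAt (fun x => η x 1) (‖deriv η θ‖ * cos θ) θ := by
  refine (hasDerivAt_coord (hs.differentiable (by simp) θ).hasDerivAt 1).congr_deriv ?_
  simpa [unitTangent] using congrArg (fun v : Plane => v 1) (hη.angle θ)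

/-- Since the velocity is tangent to `T`, differentiating `h = ⟨γ, -N⟩` gives `h' = ⟨γ, T⟩`, and
once more `h'' = |γ_θ| - h`. -/
theorem iteratedDeriv_two_support_add (hη : IsLocallyConvexClosed w η) (hs : ContDiff ℝ ∞ η)
    (θ : ℝ) : iteratedDeriv 2 (support η) θ + support η θ = ‖deriv η θ‖ := by
  have h0 := hη.hasDerivAt_coord_zero hs
  have h1 := hη.hasDerivAt_coord_one hs
  have e0 : support η = fun x => η x 0 * cos x + η x 1 * sin x := funext (support_eq η)
  have e1 : deriv (support η) = fun x => η x 1 * cos x - η x 0 * sin x := by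
    funext x
    rw [e0]
    refine (((h0 x).mul (hasDerivAt_cos x)).add ((h1 x).mul (hasDerivAt_sin x))).deriv.trans ?_
    ring
  have e2 : deriv (deriv (support η)) θ = ‖deriv η θ‖ - support η θ := by
    rw [e1, e0]
    refine (((h1 θ).mul (hasDerivAt_cos θ)).sub ((h0 θ).mul (hasDerivAt_sin θ))).deriv.trans ?_
    linear_combination ‖deriv η θ‖ * sin_sq_add_cos_sq θ
  rw [iteratedDeriv_succ, iteratedDeriv_one, e2]
  ring

theorem norm_deriv_pos (hη : IsLocallyConvexClosed w η) (θ : ℝ) : 0 < ‖deriv η θ‖ :=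
  norm_pos_iff.2 (hη.regular θ)

/-- From `γ_θ = ρ T` and `T_θ = N` follows `γ_θθ = ρ' T + ρ N`, whose normal component is `ρ`. -/
theorem curvature_eq (hη : IsLocallyConvexClosed w η) (hs : ContDiff ℝ ∞ η) (θ : ℝ) :
    curvature η θ = ‖deriv η θ‖⁻¹ := by
  have hs' : ContDiff ℝ ∞ (deriv η) := ((contDiff_infty_iff_deriv (f := η)).1 hs).2
  have hρ : DifferentiableAt ℝ (fun x => ‖deriv η x‖) θ :=
    (hs'.differentiable (by simp) θ).norm ℝ (hη.regular θ)
  have hd := (hs'.differentiable (by simp) θ).hasDerivAt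
  have e0 : deriv (deriv η) θ 0 = -(deriv (fun x => ‖deriv η x‖) θ * sin θ +
      ‖deriv η θ‖ * cos θ) := by
    refine (hasDerivAt_coord hd 0).unique ?_
    have : (fun x => deriv η x 0) = fun x => -(‖deriv η x‖ * sin x) := funext fun x =>
      (hasDerivAt_coord (hs.differentiable (by simp) x).hasDerivAt 0).unique
        (hη.hasDerivAt_coord_zero hs x)
    rw [this]
    exact (hρ.hasDerivAt.mul (hasDerivAt_sin θ)).neg
  have e1 : deriv (deriv η) θ 1 = deriv (fun x => ‖deriv η x‖) θ * cos θ +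
      ‖deriv η θ‖ * -sin θ := by
    refine (hasDerivAt_coord hd 1).unique ?_
    have : (fun x => deriv η x 1) = fun x => ‖deriv η x‖ * cos x := funext fun x =>
      (hasDerivAt_coord (hs.differentiable (by simp) x).hasDerivAt 1).unique
        (hη.hasDerivAt_coord_one hs x)
    rw [this]
    exact hρ.hasDerivAt.mul (hasDerivAt_cos θ)
  have hne := (hη.norm_deriv_pos θ).ne'
  have e2 : ⟪deriv (deriv η) θ, inwardNormal θ⟫_ℝ = ‖deriv η θ‖ := by
    rw [inner_plane, e0, e1]
    simp only [inwardNormal, PiLp.toLp_apply, Matrix.cons_val_zero, Matrix.cons_val_one]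
    linear_combination ‖deriv η θ‖ * sin_sq_add_cos_sq θ
  rw [curvature, iteratedDeriv_succ, iteratedDeriv_one, e2]
  field_simp

theorem periodic_support (hη : IsLocallyConvexClosed w η) :
    Function.Periodic (support η) (2 * w * π) := fun θ => by
  have h1 : cos (θ + 2 * w * π) = cos θ := by
    rw [mul_comm 2 (w : ℝ), mul_assoc, cos_add_nat_mul_two_pi]
  have h2 : sin (θ + 2 * w * π) = sin θ := by
    rw [mul_comm 2 (w : ℝ), mul_assoc, sin_add_nat_mul_two_pi]
  rw [support_eq, support_eq, hη.periodic θ, h1, h2]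

end IsLocallyConvexClosed

/-! ### The rescaled geometric flow -/

theorem scaleFactor_originalTime {L₀ c : ℝ} (hL₀ : 0 < L₀) (hc : c ≠ 0) (τ : ℝ) :
    scaleFactor L₀ c (originalTime L₀ c τ) = L₀ * exp (c * τ) := by
  have h1 : L₀ ^ 2 + 2 * c * originalTime L₀ c τ = (L₀ * exp (c * τ)) ^ 2 := by
    have h2 : exp (2 * c * τ) = exp (c * τ) ^ 2 := by
      rw [← exp_nat_mul]
      congr 1
      push_cast
      ring
    rw [originalTime, h2]
    field_simp
    ring
  rw [scaleFactor, h1, sqrt_sq (by positivity)]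

theorem originalTime_pos {L₀ c τ : ℝ} (hL₀ : 0 < L₀) (hc : 0 < c) (hτ : 0 < τ) :
    0 < originalTime L₀ c τ := by
  have : 0 < exp (2 * c * τ) - 1 := sub_pos.2 (one_lt_exp_iff.2 (by positivity))
  rw [originalTime]
  positivity

theorem contDiff_originalTime (L₀ c : ℝ) : ContDiff ℝ ∞ (originalTime L₀ c) := by
  unfold originalTime
  fun_prop

namespace IsGlobalFlow

variable {w : ℕ} {γ : ℝ → ℝ → Plane} {L₀ c t : ℝ}

theorem contDiffAt (hγ : IsGlobalFlow w γ) (ht : 0 < t) (θ : ℝ) :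
    ContDiffAt ℝ ∞ (fun p : ℝ × ℝ => γ p.1 p.2) (t, θ) :=
  hγ.smooth.contDiffAt ((isOpen_Ioi.prod isOpen_univ).mem_nhds ⟨ht, mem_univ θ⟩)

theorem contDiff_slice (hγ : IsGlobalFlow w γ) (ht : 0 < t) : ContDiff ℝ ∞ (γ t) := by
  rw [contDiff_iff_contDiffAt]
  intro θ
  exact (hγ.contDiffAt ht θ).comp θ (f := fun x : ℝ => (t, x)) (by fun_prop)

theorem smooth_support (hγ : IsGlobalFlow w γ) : SmoothFamily fun t => support (γ t) := by
  have hcoord : ∀ i, SmoothFamily fun t θ => γ t θ i := fun i =>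
    SmoothFamily.of_contDiffAt fun t ht θ =>
      (EuclideanSpace.proj (𝕜 := ℝ) i).contDiff.contDiffAt.comp (t, θ) (hγ.contDiffAt ht θ)
  have hcos : SmoothFamily fun _ θ => cos θ :=
    (contDiff_cos.comp contDiff_snd).contDiffOn
  have hsin : SmoothFamily fun _ θ => sin θ :=
    (contDiff_sin.comp contDiff_snd).contDiffOn
  exact (((hcoord 0).mul hcos).add ((hcoord 1).mul hsin)).congr fun t _ θ => support_eq (γ t) θ

/-- At fixed `θ` the normal does not depend on time, so `h_t` is minus the normal velocity. -/
theorem hasDerivAt_support (hγ : IsGlobalFlow w γ) (ht : 0 < t) (θ : ℝ) :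
    HasDerivAt (fun s => support (γ s) θ)
      (iteratedDeriv 2 (curvature (γ t)) θ + curvature (γ t) θ) t := by
  have hd : HasDerivAt (fun s => γ s θ) (deriv (fun s => γ s θ) t) t := by
    refine DifferentiableAt.hasDerivAt ?_
    exact ((hγ.contDiffAt ht θ).differentiableAt (by simp)).comp t
      (f := fun s : ℝ => (s, θ)) (by fun_prop)
  have h1 := hγ.velocity t ht θ
  rw [inner_plane] at h1
  simp only [inwardNormal, PiLp.toLp_apply, Matrix.cons_val_zero, Matrix.cons_val_one] at h1
  have h2 : (fun s => support (γ s) θ) = fun s => γ s θ 0 * cos θ + γ s θ 1 * sin θ :=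
    funext fun s => support_eq (γ s) θ
  rw [h2]
  refine (((hasDerivAt_coord hd 0).mul_const _).add
    ((hasDerivAt_coord hd 1).mul_const _)).congr_deriv ?_
  linarith

theorem rescaled_convex (hγ : IsGlobalFlow w γ) (hL₀ : 0 < L₀) (hc : 0 < c) (ht : 0 < t) :
    IsLocallyConvexClosed w (rescaled L₀ c γ t) := by
  refine (hγ.convex _ (originalTime_pos hL₀ hc ht)).smul ?_
  rw [scaleFactor_originalTime hL₀ hc.ne']
  positivity

theorem contDiff_rescaled (hγ : IsGlobalFlow w γ) (hL₀ : 0 < L₀) (hc : 0 < c) (ht : 0 < t) :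
    ContDiff ℝ ∞ (rescaled L₀ c γ t) :=
  (hγ.contDiff_slice (originalTime_pos hL₀ hc ht)).const_smul _

theorem support_rescaled (hL₀ : 0 < L₀) (hc : 0 < c) (γ : ℝ → ℝ → Plane) (t θ : ℝ) :
    support (rescaled L₀ c γ t) θ =
      (L₀ * exp (c * t))⁻¹ * support (γ (originalTime L₀ c t)) θ := by
  rw [← scaleFactor_originalTime hL₀ hc.ne']
  exact support_smul _ _ _

theorem curvature_rescaled (hγ : IsGlobalFlow w γ) (hL₀ : 0 < L₀) (hc : 0 < c) (ht : 0 < t)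
    (θ : ℝ) : curvature (rescaled L₀ c γ t) θ =
      L₀ * exp (c * t) * curvature (γ (originalTime L₀ c t)) θ := by
  have hT := originalTime_pos hL₀ hc ht
  have hd : deriv (rescaled L₀ c γ t) θ =
      (L₀ * exp (c * t))⁻¹ • deriv (γ (originalTime L₀ c t)) θ := by
    rw [← scaleFactor_originalTime hL₀ hc.ne']
    exact deriv_fun_const_smul_field _ _
  rw [(hγ.rescaled_convex hL₀ hc ht).curvature_eq (hγ.contDiff_rescaled hL₀ hc ht),
    (hγ.convex _ hT).curvature_eq (hγ.contDiff_slice hT), hd, norm_smul, mul_inv, norm_inv,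
    inv_inv, norm_of_nonneg (by positivity)]

theorem curvature_rescaled_eq_curv (hγ : IsGlobalFlow w γ) (hL₀ : 0 < L₀) (hc : 0 < c)
    (ht : 0 < t) : curvature (rescaled L₀ c γ t) =
      curv (fun t => support (rescaled L₀ c γ t)) t := funext fun θ => by
  have h1 := hγ.rescaled_convex hL₀ hc ht
  have h2 := hγ.contDiff_rescaled hL₀ hc ht
  rw [h1.curvature_eq h2, curv, radius, h1.iteratedDeriv_two_support_add h2]

/-- In the new time `φ = L₀ e^{cτ}`. The derivative of `1/φ` produces `-c h`; the factor `φ²` from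
the time change, times `1/φ`, is the factor `φ` by which the curvature scales. -/
theorem hasDerivAt_support_rescaled (hγ : IsGlobalFlow w γ) (hL₀ : 0 < L₀) (hc : 0 < c)
    (ht : 0 < t) (θ : ℝ) : HasDerivAt (fun s => support (rescaled L₀ c γ s) θ)
      (iteratedDeriv 2 (curvature (rescaled L₀ c γ t)) θ + curvature (rescaled L₀ c γ t) θ -
        c * support (rescaled L₀ c γ t) θ) t := by
  have hT := originalTime_pos hL₀ hc ht
  have h1 := (hγ.hasDerivAt_support hT θ).comp t (hasDerivAt_originalTime L₀ hc.ne' t)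
  have h2 : HasDerivAt (fun s => (L₀ * exp (c * s))⁻¹) (-c * (L₀ * exp (c * t))⁻¹) t := by
    have hne : L₀ * exp (c * t) ≠ 0 := by positivity
    refine ((((hasDerivAt_id t).const_mul c).exp.const_mul L₀).inv hne).congr_deriv ?_
    simp only [id]
    field_simp
  have h3 : (fun s => support (rescaled L₀ c γ s) θ) = fun s =>
      (L₀ * exp (c * s))⁻¹ * support (γ (originalTime L₀ c s)) θ :=
    funext fun s => support_rescaled hL₀ hc γ s θ
  have h4 : curvature (rescaled L₀ c γ t) = fun θ =>
      L₀ * exp (c * t) * curvature (γ (originalTime L₀ c t)) θ :=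
    funext (hγ.curvature_rescaled hL₀ hc ht)
  rw [h3, h4, iteratedDeriv_const_mul_field, support_rescaled hL₀ hc]
  refine (h2.mul h1).congr_deriv ?_
  rw [scaleFactor_originalTime hL₀ hc.ne', Function.comp_apply]
  have hne : L₀ * exp (c * t) ≠ 0 := by positivity
  field_simp
  ring

theorem supportFlow_rescaled (hγ : IsGlobalFlow w γ) (hL₀ : 0 < L₀) (hc : 0 < c) :
    SupportFlow w c fun t => support (rescaled L₀ c γ t) where
  smooth := by
    have h1 : SmoothFamily fun t θ => support (γ (originalTime L₀ c t)) θ :=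
      SmoothFamily.of_contDiffAt fun t ht θ =>
        (hγ.smooth_support.contDiffAt (originalTime_pos hL₀ hc ht) θ).comp (t, θ)
          (f := fun p : ℝ × ℝ => (originalTime L₀ c p.1, p.2))
          (((contDiff_originalTime L₀ c).comp contDiff_fst).prodMk contDiff_snd).contDiffAt
    have h2 : SmoothFamily fun t _ => (L₀ * exp (c * t))⁻¹ := by
      refine SmoothFamily.inv (F := fun t _ => L₀ * exp (c * t)) ?_ fun t _ _ => by positivity
      exact ContDiff.contDiffOn (by fun_prop)
    exact (h2.mul h1).congr fun t _ θ => support_rescaled hL₀ hc γ t θ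
  periodic t ht := (hγ.rescaled_convex hL₀ hc ht).periodic_support
  radius_pos t ht θ := by
    have h1 := hγ.rescaled_convex hL₀ hc ht
    rw [radius, h1.iteratedDeriv_two_support_add (hγ.contDiff_rescaled hL₀ hc ht)]
    exact h1.norm_deriv_pos θ
  evolution t ht θ := by
    have := hγ.hasDerivAt_support_rescaled hL₀ hc ht θ
    rwa [hγ.curvature_rescaled_eq_curv hL₀ hc ht] at this

end IsGlobalFlow

end EntropyFlow

end

/-! ### Assembly of the three claims -/

/-- Exponential decay of all derivatives of the support function along the rescaled entropy flow,
and its smooth convergence to a positive constant. The factor `φ(t) = √(L₀² + 8 w² π² t)` is the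
case `c = 4 w² π²`; the rescaled equation `h_t = k_θθ + k - h` is the case `c = 1`. -/
theorem proposition6 (w : ℕ) (hw : 1 ≤ w) (γ : ℝ → ℝ → EntropyFlow.Plane)
    (hγ : EntropyFlow.IsGlobalFlow w γ) (L₀ c : ℝ) (hL₀ : 0 < L₀) (hc : 0 < c)
    (h k : ℝ → ℝ → ℝ)
    (hh : h = fun t => EntropyFlow.support (EntropyFlow.rescaled L₀ c γ t))
    (hk : k = fun t => EntropyFlow.curvature (EntropyFlow.rescaled L₀ c γ t)) :
    (∀ t, 0 < t → ∀ θ, HasDerivAt (fun s => h s θ)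
      (iteratedDeriv 2 (k t) θ + k t θ - c * h t θ) t) ∧
    (∀ T : ℝ, ∃ ε α t₁ : ℕ → ℝ,
      (∀ i, 1 ≤ i → 0 < ε i ∧ ε i ≤ 1 / (22 * w * π)) ∧
      (∀ i, 1 ≤ i → T ≤ t₁ i ∧ 0 < t₁ i ∧ t₁ i ≤ t₁ (i + 1)) ∧
      (∀ i, 1 ≤ i → ∀ t, t₁ i ≤ t →
        ∫ θ in (0 : ℝ)..(2 * w * π), (deriv (fun x => Real.log (k t x)) θ) ^ 2 ≤ ε i) ∧
      (∀ i, 1 ≤ i → ∀ t, t₁ i ≤ t →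
        ∫ θ in (0 : ℝ)..(2 * w * π), (iteratedDeriv i (h t) θ) ^ 2
          ≤ α i * Real.exp (-2 * c * t))) ∧
    (∃ r : ℝ, 0 < r ∧ ∀ i : ℕ, TendstoUniformly (fun t θ => iteratedDeriv i (h t) θ)
      (iteratedDeriv i (fun _ : ℝ => r)) atTop) := by

  have hf := hγ.supportFlow_rescaled hL₀ hc
  rw [← hh] at hf
  have hkc : ∀ t, 0 < t → k t = EntropyFlow.curv h t := fun t ht => by
    rw [hk, hh]
    exact hγ.curvature_rescaled_eq_curv hL₀ hc ht
  have hw' : (1 : ℝ) ≤ w := by exact_mod_cast hw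
  refine ⟨fun t ht θ => ?_, fun T => ?_, (√c)⁻¹, by positivity,
    hf.tendstoUniformly_iteratedDeriv hw hc⟩
  · rw [hkc t ht]
    exact hf.evolution t ht θ
  · have hε : 0 < 1 / (22 * (w : ℝ) * π) := by positivity
    obtain ⟨T₀, hT₀⟩ := eventually_atTop.1
      ((hf.tendsto_integral_sq_deriv_log_curv hw hc).eventually (ge_mem_nhds hε))
    -- The condition `1 ≤ i` sits inside the existential so that constants can be chosen for every
    -- `i`; those at `i = 0` are dummies.
    have hdecay : ∀ i : ℕ, ∃ C S : ℝ, 1 ≤ i → ∀ t, S ≤ t →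
        EntropyFlow.energy (2 * w * π) h i t ≤ C * Real.exp (-2 * c * t) := fun i => by
      by_cases hi : 1 ≤ i
      · obtain ⟨C, hC⟩ := hf.energy_decay hw hc hi
        obtain ⟨S, hS⟩ := eventually_atTop.1 hC
        exact ⟨C, S, fun _ => hS⟩
      · exact ⟨0, 0, fun h => absurd h hi⟩
    choose α S hS using hdecay
    -- Partial sums of `|S j|` make the times monotone and at least `S i`; the remaining terms put
    -- them above `T`, `T₀` and `0`.
    set t₁ : ℕ → ℝ := fun i => |T| + |T₀| + 1 + ∑ j ∈ Finset.range (i + 1), |S j| with ht₁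
    have hsum : ∀ i, 0 ≤ ∑ j ∈ Finset.range (i + 1), |S j| := fun i =>
      Finset.sum_nonneg fun _ _ => abs_nonneg _
    have hST : ∀ i, S i ≤ t₁ i := fun i => by
      have h1 := Finset.single_le_sum (f := fun j => |S j|) (fun j _ => abs_nonneg (S j))
        (Finset.self_mem_range_succ i)
      simp only [ht₁]
      linarith [le_abs_self (S i), abs_nonneg T, abs_nonneg T₀]
    have hTt : ∀ i, T ≤ t₁ i ∧ T₀ ≤ t₁ i ∧ 0 < t₁ i := fun i => by
      simp only [ht₁]
      refine ⟨?_, ?_, ?_⟩ <;>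
        linarith [hsum i, le_abs_self T, le_abs_self T₀, abs_nonneg T, abs_nonneg T₀]
    refine ⟨fun _ => 1 / (22 * w * π), α, t₁, fun i _ => ⟨hε, le_rfl⟩,
      fun i _ => ⟨(hTt i).1, (hTt i).2.2, ?_⟩, fun i _ t ht => ?_,
      fun i hi t ht => hS i hi t ((hST i).trans ht)⟩
    · simp only [ht₁]
      rw [Finset.sum_range_succ _ (i + 1)]
      linarith [abs_nonneg (S (i + 1))]
    · rw [hkc t ((hTt i).2.2.trans_le ht)]
      exact hT₀ t ((hTt i).2.1.trans ht)
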